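/- Let $n\ge 2$. Let $\mathbb R^{n,1}=\mathbb R^n\times\mathbb R$ carry the Lorentzian form $\langle X,Y\rangle=X'\cdot Y'-X_{n+1}Y_{n+1}$, let $\mathbb H=\{x\in\mathbb R^{n,1}:\langle x,x\rangle=-1,\ x_{n+1}>0\}$ be the future unit hyperboloid, fix a point $o\in\mathbb H$, and let $r(x)=\operatorname{arcosh}(-\langle o,x\rangle)$ be the hyperbolic distance from $o$ to $x$. For a smooth function $\varphi:\mathbb H\to\mathbb R$, the radial graph of $\varphi$ is the hypersurface $\{e^{\varphi(x)}x : x\in\mathbb H\}\subset\mathbb R^{n,1}$. It is called spacelike if the metric induced on it is Riemannian. In that case let $N$ be its future oriented unit normal field ($\langle N,N\rangle=-1$), let its principal curvatures $\kappa_1,\dots,\kappa_n$ at a point be the eigenvalues of the curvature endomorphism $dN$, and let $H_2=\sigma_2(\kappa_1,\dots,\kappa_n)$ be the second elementary symmetric function of them; the graph is called strictly convex if its second fundamental form $\langle dN\,\cdot,\cdot\rangle$ is positive definite everywhere (equivalently, all $\kappa_i>0$). Put $$F_2(\varphi)(x)=e^{\varphi(x)}\left[\frac{1}{\binom n2}H_2\big(e^{\varphi(x)}x\big)\right]^{1/2},\qquad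 x\in\mathbb H .$$ Let $h:\mathbb H\to\mathbb R$ be a positive continuous function with $h(x)\to 1$ as $r(x)\to+\infty$, and suppose that the functions $h^-(r)=\sup_{r(x)=r}h(x)$ and $h^+(r)=\inf_{r(x)=r}h(x)$ on $[0,+\infty)$ satisfy $$\int_0^{+\infty}(h^--1)_+\,dr<+\infty,\qquad \int_0^{+\infty}(1-h^+)_+\,dr<+\infty,$$ where $(\cdot)_+$ denotes the positive part. Then there exist $\varphi^-,\varphi^+\in C^\infty(\mathbb H)$, both radial (that is, functions of $r(x)$ only), whose radial graphs are spacelike and strictly convex, such that $$F_2(\varphi^-)\ge h,\qquad F_2(\varphi^+)\le h\quad\text{on }\mathbb H,\qquad \lim_{r(x)\to+\infty}\varphi^\pm(x)=0 .$$ -/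

import Mathlib

open Filter Topology MeasureTheory
open scoped ContDiff

noncomputable section

/-- The Minkowski space `ℝ^{n,1} = ℝⁿ × ℝ`, with points `X = (X', X_{n+1})`. -/
abbrev Mink (n : ℕ) : Type := EuclideanSpace ℝ (Fin n) × ℝ

/-- The Lorentzian inner product `⟨X, Y⟩ = X' · Y' - X_{n+1} Y_{n+1}`. -/
def minkInner {n : ℕ} (X Y : Mink n) : ℝ := inner ℝ X.1 Y.1 - X.2 * Y.2

/-- The future unit hyperboloid, as a subspace of the Minkowski space. -/
abbrev Hyp (n : ℕ) : Type := {x : Mink n // minkInner x x = -1 ∧ 0 < x.2}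

/-- The hyperbolic distance from `o` to `x`. -/
def hypDist {n : ℕ} (o x : Hyp n) : ℝ := Real.arcosh (-minkInner o.1 x.1)

/-- The global chart of the hyperboloid: its point over `y ∈ ℝⁿ`. -/
def hypPoint {n : ℕ} (y : EuclideanSpace ℝ (Fin n)) : Hyp n :=
  ⟨(y, √(1 + ‖y‖ ^ 2)), by
    have h : (0 : ℝ) < 1 + ‖y‖ ^ 2 := by positivity
    refine ⟨?_, Real.sqrt_pos.2 h⟩
    simp only [minkInner, real_inner_self_eq_norm_sq, Real.mul_self_sqrt h.le]
    ring⟩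

/-- `φ` is of class `C^∞` on the hyperboloid. -/
def HypSmooth {n : ℕ} (φ : Hyp n → ℝ) : Prop :=
  ContDiff ℝ ∞ fun y : EuclideanSpace ℝ (Fin n) => φ (hypPoint y)

/-- The parametrization `x ↦ e^{φ(x)} x` of the radial graph of `φ`, read in the chart of the
hyperboloid. -/
def radialGraph {n : ℕ} (φ : Hyp n → ℝ) (y : EuclideanSpace ℝ (Fin n)) : Mink n :=
  Real.exp (φ (hypPoint y)) • (hypPoint y).1

/-- The radial graph of `φ` is spacelike: the metric induced on it is Riemannian. -/
def IsSpacelike {n : ℕ} (φ : Hyp n → ℝ) : Prop :=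
  ∀ y v : EuclideanSpace ℝ (Fin n), v ≠ 0 →
    0 < minkInner (fderiv ℝ (radialGraph φ) y v) (fderiv ℝ (radialGraph φ) y v)

/-- `ν` is a future oriented unit normal of the radial graph of `φ` at the point over `y`. -/
def IsFutureUnitNormal {n : ℕ} (φ : Hyp n → ℝ) (y : EuclideanSpace ℝ (Fin n))
    (ν : Mink n) : Prop :=
  (∀ v, minkInner ν (fderiv ℝ (radialGraph φ) y v) = 0) ∧ minkInner ν ν = -1 ∧ 0 < ν.2

open Classical in
/-- The future oriented unit normal field `N` of the radial graph of `φ`, read in the chart of the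
hyperboloid. (For a spacelike graph there is exactly one such normal at each point.) -/
def futureNormal {n : ℕ} (φ : Hyp n → ℝ) (y : EuclideanSpace ℝ (Fin n)) : Mink n :=
  if h : ∃ ν, IsFutureUnitNormal φ y ν then h.choose else 0

/-- The curvature endomorphism `dN` of the radial graph at the point over `y`. The tangent space of
the graph is identified with `ℝⁿ` by the differential `dX` of the parametrization `X`; so this is
the endomorphism `S` with `dX (S v) = dN v`. -/
def curvatureEndo {n : ℕ} (φ : Hyp n → ℝ) (y : EuclideanSpace ℝ (Fin n)) :
    EuclideanSpace ℝ (Fin n) →ₗ[ℝ] EuclideanSpace ℝ (Fin n) :=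
  (fderiv ℝ (radialGraph φ) y : EuclideanSpace ℝ (Fin n) →ₗ[ℝ] Mink n).leftInverse ∘ₗ
    (fderiv ℝ (futureNormal φ) y : EuclideanSpace ℝ (Fin n) →ₗ[ℝ] Mink n)

/-- The principal curvatures of the radial graph at the point over `y`: the eigenvalues, with
multiplicity, of the curvature endomorphism. -/
def principalCurvatures {n : ℕ} (φ : Hyp n → ℝ) (y : EuclideanSpace ℝ (Fin n)) : Multiset ℝ :=
  (curvatureEndo φ y).charpoly.roots

/-- The `m`-th mean curvature `H_m`: the `m`-th elementary symmetric function of the principal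
curvatures. -/
def meanCurvature {n : ℕ} (m : ℕ) (φ : Hyp n → ℝ) (y : EuclideanSpace ℝ (Fin n)) : ℝ :=
  (principalCurvatures φ y).esymm m

/-- The radial graph of `φ` is strictly convex: its second fundamental form with respect to the
future unit normal, `⟨dN v, dX v⟩`, is positive definite. -/
def IsStrictlyConvexGraph {n : ℕ} (φ : Hyp n → ℝ) : Prop :=
  ∀ y v : EuclideanSpace ℝ (Fin n), v ≠ 0 →
    0 < minkInner (fderiv ℝ (futureNormal φ) y v) (fderiv ℝ (radialGraph φ) y v)

/-- The radial operator `F_m(φ) = e^φ [H_m / (n choose m)]^{1/m}`; the chart maps `x` to `x'`. -/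
def radialOp {n : ℕ} (m : ℕ) (φ : Hyp n → ℝ) (x : Hyp n) : ℝ :=
  Real.exp (φ x) * (meanCurvature m φ x.1.1 / (n.choose m : ℝ)) ^ (1 / (m : ℝ))

/-- `h^-(r)`, the supremum of `h` over the sphere of radius `r` about `o`. -/
def sphereSup {n : ℕ} (o : Hyp n) (h : Hyp n → ℝ) (r : ℝ) : ℝ :=
  sSup (h '' {x | hypDist o x = r})

/-- `h^+(r)`, the infimum of `h` over the sphere of radius `r` about `o`. -/
def sphereInf {n : ℕ} (o : Hyp n) (h : Hyp n → ℝ) (r : ℝ) : ℝ :=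
  sInf (h '' {x | hypDist o x = r})

/-- `φ(x)` tends to `l` as `r(x) → +∞`. -/
def TendsToAtInfinity {n : ℕ} (o : Hyp n) (φ : Hyp n → ℝ) (l : ℝ) : Prop :=
  Tendsto φ (comap (hypDist o) atTop) (𝓝 l)

/-- `φ` factors through the hyperbolic distance to `o`. -/
def IsRadial {n : ℕ} (o : Hyp n) (φ : Hyp n → ℝ) : Prop :=
  ∃ f : ℝ → ℝ, ∀ x, φ x = f (hypDist o x)

end

/-!
Write `t = cosh r = -⟨o, x⟩`. A radial function `φ = Φ(t)` is described by its slope function `β`,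
which is `dΦ/dt = β / W` with `W = √(1 + β² (t² - 1))`; then the future unit normal of the graph is
`N = (W + t β) x - β o`, and every smooth `β` gives a spacelike graph. Differentiating `N` shows
that `e^φ` times the curvature endomorphism is the rank-one perturbation `α id + β' dt ⊗ ∇t` of a
homothety (`curvatureEndo_eq`), with `α = W + t β`. So the principal curvatures, multiplied by
`e^φ`, are `k₂ = α` with multiplicity `n - 1` and `k₁ = α + β' (t² - 1)`, and
`F_2(φ)² = (2 / n) k₁ k₂ + ((n - 2) / n) k₂²` does not involve `φ` itself
(`IsRadialProfile.radialOp_eq`). The constant in `Φ` is therefore free, and `φ → 0` at infinity can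
be achieved as soon as `β` is integrable in `t`.

Put `σ = β sinh r`, so that `W = √(1 + σ²)` and `k₁ = W + dσ/dr`. If `σ ≥ 0` and
`dσ/dr + σ / 2 ≥ d ≥ 0`, then `k₁ k₂ ≥ (W - σ / 2 + d) (W + σ) ≥ 1 + d`; symmetrically, for the
slope function `-β` with `d ≤ 1 / 4`, `k₁ k₂ ≤ (W + σ / 2 - d) (W - σ) ≤ 1 - d`
(`mul_le_of_damped`). Thus near infinity both barriers come from one linear damped equation,
solved explicitly in the variable `t` by `dampedSlope`, whose solutions are integrable in `t` when
`δ / t` is, for the source `δ`.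

On a bounded set the barriers are controlled by the homogeneous part of the solution. For the
subsolution a large multiple of `t^(-3/2)` makes `F_2` large (`exists_radial_subsolution`). For the
supersolution a multiple of `(t + L)^(-3/2)` with `L` large is almost constant and slightly less
than `1` there, which makes both curvatures small but positive; the source is switched on
only beyond `L` (`exists_radial_supersolution`).

Finally, the integrability hypotheses on the suprema and infima of `h` over spheres provide a smooth
integrable source (`exists_smooth_majorant`); these suprema and infima are continuous in `r` by
compactness, because Lorentz boosts give polar coordinates about any point `o`.
-/

/-! ### Rank-one perturbations of a homothety -/

open Polynomial in
theorem LinearMap.charpoly_smulRight {V : Type*} [AddCommGroup V] [Module ℝ V]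
    [FiniteDimensional ℝ V] (l : V →ₗ[ℝ] ℝ) (z : V) (hV : 0 < Module.finrank ℝ V) :
    (l.smulRight z).charpoly = X ^ (Module.finrank ℝ V - 1) * (X - C (l z)) := by
  classical
  let b := Module.finBasis ℝ V
  have hM : LinearMap.toMatrix b b (l.smulRight z)
      = Matrix.vecMulVec (fun i => b.repr z i) (fun j => l (b j)) := by
    ext i j
    simp [LinearMap.toMatrix_apply, Matrix.vecMulVec_apply, mul_comm]
  have hd : (fun i => b.repr z i) ⬝ᵥ (fun j => l (b j)) = l z := by
    have h := congrArg l (b.sum_repr z)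
    rw [map_sum] at h
    rw [← h]
    simp [dotProduct]
  rw [← LinearMap.charpoly_toMatrix _ b, hM, Matrix.charpoly_vecMulVec, hd, Fintype.card_fin,
    mul_sub, ← pow_succ, Nat.sub_add_cancel hV, smul_eq_C_mul, mul_comm (C _)]

open Polynomial in
theorem LinearMap.charpoly_smul_one_add_smulRight {V : Type*} [AddCommGroup V] [Module ℝ V]
    [FiniteDimensional ℝ V] (a : ℝ) (l : V →ₗ[ℝ] ℝ) (z : V) (hV : 0 < Module.finrank ℝ V) :
    (a • (1 : Module.End ℝ V) + l.smulRight z).charpoly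
      = (X - C a) ^ (Module.finrank ℝ V - 1) * (X - C (a + l z)) := by
  have h : a • (1 : Module.End ℝ V) + l.smulRight z
      = l.smulRight z - (-a) • (1 : Module.End ℝ V) := by
    rw [neg_smul, sub_neg_eq_add, add_comm]
  rw [h, LinearMap.charpoly_sub_smul, LinearMap.charpoly_smulRight l z hV]
  simp only [Polynomial.mul_comp, Polynomial.pow_comp, Polynomial.sub_comp, Polynomial.X_comp,
    Polynomial.C_comp, map_neg, map_add]
  ring

theorem Multiset.esymm_two_cons {R : Type*} [CommSemiring R] (a : R) (s : Multiset R) :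
    (a ::ₘ s).esymm 2 = s.esymm 2 + a * s.sum := by
  have h : ∀ t : Multiset R, t.esymm 2 = ((t.powersetCard 2).map Multiset.prod).sum := fun _ => rfl
  rw [h, h, Multiset.powersetCard_cons 1, Multiset.map_add, Multiset.sum_add,
    Multiset.powersetCard_one, Multiset.map_map, Multiset.map_map]
  simp only [Function.comp_def, Multiset.prod_cons, Multiset.prod_singleton]
  rw [Multiset.sum_map_mul_left, Multiset.map_id']

theorem Multiset.esymm_two_replicate (k : ℕ) (a : ℝ) :
    (Multiset.replicate k a).esymm 2 = (k.choose 2 : ℝ) * a ^ 2 := by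
  induction k with
  | zero => simp [Multiset.esymm, Multiset.powersetCard_zero_right]
  | succ k ih =>
    rw [Multiset.replicate_succ, Multiset.esymm_two_cons, ih, Multiset.sum_replicate,
      Nat.choose_succ_succ' k 1, Nat.choose_one_right]
    push_cast
    simp only [nsmul_eq_mul]
    ring

/-- The normalized `σ₂` of the eigenvalues of a rank-one perturbation of a homothety: all
eigenvalues but one are equal to `a`, and the last one is `a + l z`. -/
theorem esymm_two_roots_charpoly {n : ℕ} (hn : 2 ≤ n) (a : ℝ)
    (l : EuclideanSpace ℝ (Fin n) →ₗ[ℝ] ℝ) (z : EuclideanSpace ℝ (Fin n)) :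
    ((a • (1 : Module.End ℝ (EuclideanSpace ℝ (Fin n))) + l.smulRight z).charpoly.roots).esymm 2
        / (n.choose 2 : ℝ)
      = 2 / n * ((a + l z) * a) + (n - 2) / n * a ^ 2 := by
  have hf : Module.finrank ℝ (EuclideanSpace ℝ (Fin n)) = n := by simp
  have hr : ((a • (1 : Module.End ℝ (EuclideanSpace ℝ (Fin n)))
      + l.smulRight z).charpoly.roots) = (a + l z) ::ₘ Multiset.replicate (n - 1) a := by
    rw [LinearMap.charpoly_smul_one_add_smulRight a l z (by omega), hf, Polynomial.roots_mul
      (mul_ne_zero (pow_ne_zero _ (Polynomial.X_sub_C_ne_zero _)) (Polynomial.X_sub_C_ne_zero _)),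
      Polynomial.roots_pow, Polynomial.roots_X_sub_C, Polynomial.roots_X_sub_C,
      Multiset.nsmul_singleton, add_comm, Multiset.singleton_add]
  rw [hr, Multiset.esymm_two_cons, Multiset.esymm_two_replicate, Multiset.sum_replicate]
  generalize a + l z = b
  clear hr hf l z
  obtain ⟨k, rfl⟩ := Nat.exists_eq_add_of_le hn
  have h1 : 2 + k - 1 = k + 1 := by omega
  have hc : ∀ m : ℕ, ((m + 1).choose 2 : ℝ) = (m + 1) * m / 2 := by
    intro m
    rw [Nat.cast_choose_two]
    push_cast
    ring
  rw [h1, hc k, show 2 + k = k + 1 + 1 by ring, hc (k + 1)]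
  push_cast
  simp only [nsmul_eq_mul]
  push_cast
  have : (k : ℝ) + 1 ≠ 0 := by positivity
  have : (k : ℝ) + 1 + 1 ≠ 0 := by positivity
  field_simp
  ring

/-! ### The Lorentzian form -/

section MinkInner

variable {n : ℕ}

theorem minkInner_comm (X Y : Mink n) : minkInner X Y = minkInner Y X := by
  simp only [minkInner, real_inner_comm, mul_comm]

theorem minkInner_add_right (X Y Z : Mink n) :
    minkInner X (Y + Z) = minkInner X Y + minkInner X Z := by
  simp only [minkInner, Prod.fst_add, Prod.snd_add, inner_add_right]
  ring

theorem minkInner_smul_right (c : ℝ) (X Y : Mink n) :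
    minkInner X (c • Y) = c * minkInner X Y := by
  simp only [minkInner, Prod.smul_fst, Prod.smul_snd, real_inner_smul_right, smul_eq_mul]
  ring

theorem minkInner_sub_right (X Y Z : Mink n) :
    minkInner X (Y - Z) = minkInner X Y - minkInner X Z := by
  simp only [minkInner, Prod.fst_sub, Prod.snd_sub, inner_sub_right]
  ring

theorem minkInner_add_left (X Y Z : Mink n) :
    minkInner (X + Y) Z = minkInner X Z + minkInner Y Z := by
  rw [minkInner_comm, minkInner_add_right, minkInner_comm Z, minkInner_comm Z]

theorem minkInner_smul_left (c : ℝ) (X Y : Mink n) :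
    minkInner (c • X) Y = c * minkInner X Y := by
  rw [minkInner_comm, minkInner_smul_right, minkInner_comm]

theorem minkInner_sub_left (X Y Z : Mink n) :
    minkInner (X - Y) Z = minkInner X Z - minkInner Y Z := by
  rw [minkInner_comm, minkInner_sub_right, minkInner_comm Z, minkInner_comm Z]

/-- The continuous linear form `⟨X, ·⟩`. -/
noncomputable def minkForm (X : Mink n) : Mink n →L[ℝ] ℝ :=
  (innerSL ℝ X.1).comp (ContinuousLinearMap.fst ℝ _ _) - X.2 • ContinuousLinearMap.snd ℝ _ _

theorem minkForm_apply (X Y : Mink n) : minkForm X Y = minkInner X Y := by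
  simp [minkForm, minkInner]

theorem Hyp.inner_self (x : Hyp n) : minkInner x.1 x.1 = -1 := x.2.1

theorem Hyp.snd_sq (x : Hyp n) : x.1.2 ^ 2 = 1 + ‖x.1.1‖ ^ 2 := by
  have h := x.2.1
  simp only [minkInner, real_inner_self_eq_norm_sq] at h
  linarith

/-- `cosh` of the hyperbolic distance of `x` to `o`. -/
noncomputable def height (o x : Hyp n) : ℝ := -minkInner o.1 x.1

theorem one_le_height (o x : Hyp n) : 1 ≤ height o x := by
  have ho := o.snd_sq
  have hx := x.snd_sq
  have hcs := real_inner_le_norm o.1.1 x.1.1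
  have h1 : 1 + ‖o.1.1‖ * ‖x.1.1‖ ≤ o.1.2 * x.1.2 := by
    apply le_of_sq_le_sq _ (mul_pos o.2.2 x.2.2).le
    rw [mul_pow, ho, hx]
    nlinarith [sq_nonneg (‖o.1.1‖ - ‖x.1.1‖)]
  simp only [height, minkInner]
  linarith

theorem hypDist_nonneg (o x : Hyp n) : 0 ≤ hypDist o x :=
  Real.arcosh_nonneg (one_le_height o x)

theorem cosh_hypDist (o x : Hyp n) : Real.cosh (hypDist o x) = height o x :=
  Real.cosh_arcosh (one_le_height o x)

theorem hypPoint_fst (x : Hyp n) : hypPoint x.1.1 = x := by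
  apply Subtype.ext
  apply Prod.ext
  · rfl
  · change √(1 + ‖x.1.1‖ ^ 2) = x.1.2
    rw [← x.snd_sq, Real.sqrt_sq x.2.2.le]

/-- A unit timelike vector on the same side of the light cone as a point of the hyperboloid is
future oriented. -/
theorem snd_pos_of_minkInner_neg (N : Mink n) (x : Hyp n) (hN : minkInner N N = -1)
    (hx : minkInner N x.1 < 0) : 0 < N.2 := by
  by_contra! h
  have hxx := x.snd_sq
  have hcs := neg_le_of_abs_le (abs_real_inner_le_norm N.1 x.1.1)
  simp only [minkInner, real_inner_self_eq_norm_sq] at hN hx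
  have h1 : ‖N.1‖ ≤ -N.2 := by
    apply le_of_sq_le_sq _ (by linarith)
    nlinarith
  have h2 : ‖x.1.1‖ ≤ x.1.2 := by
    apply le_of_sq_le_sq _ x.2.2.le
    nlinarith
  nlinarith [mul_le_mul h1 h2 (norm_nonneg _) (by linarith : 0 ≤ -N.2)]

end MinkInner

/-! ### The chart of the hyperboloid -/

section Chart

variable {n : ℕ}

local notation "E" => EuclideanSpace ℝ (Fin n)

/-- The differential of the chart of the hyperboloid. -/
noncomputable def chartDeriv (y : E) : E →L[ℝ] Mink n :=
  (ContinuousLinearMap.id ℝ E).prod ((√(1 + ‖y‖ ^ 2))⁻¹ • innerSL ℝ y)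

theorem chartDeriv_apply (y v : E) :
    chartDeriv y v = (v, (√(1 + ‖y‖ ^ 2))⁻¹ * inner ℝ y v) := rfl

theorem hasFDerivAt_hypPoint (y : E) :
    HasFDerivAt (fun y : E => (hypPoint y).1) (chartDeriv y) y := by
  have h1 : HasFDerivAt (fun y : E => 1 + ‖y‖ ^ 2) (2 • innerSL ℝ y) y :=
    (hasStrictFDerivAt_norm_sq y).hasFDerivAt.const_add 1
  have h2 := h1.sqrt (by positivity)
  have h3 := (hasFDerivAt_id (𝕜 := ℝ) y).prodMk h2
  have hD : chartDeriv y
      = (ContinuousLinearMap.id ℝ E).prod ((1 / (2 * √(1 + ‖y‖ ^ 2))) • 2 • innerSL ℝ y) := by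
    rw [chartDeriv, ← Nat.cast_smul_eq_nsmul ℝ, smul_smul]
    congr 2
    push_cast
    have : √(1 + ‖y‖ ^ 2) ≠ 0 := (Real.sqrt_pos.2 (by positivity)).ne'
    field_simp
  rw [hD]
  exact h3

theorem contDiff_hypPoint : ContDiff ℝ ∞ (fun y : E => (hypPoint y).1) := by
  apply contDiff_id.prodMk
  apply ContDiff.sqrt
  · exact contDiff_const.add (contDiff_norm_sq ℝ)
  · intro y
    positivity

theorem minkInner_hypPoint_chartDeriv (y v : E) :
    minkInner (hypPoint y).1 (chartDeriv y v) = 0 := by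
  have h : √(1 + ‖y‖ ^ 2) ≠ 0 := (Real.sqrt_pos.2 (by positivity)).ne'
  change inner ℝ y v - √(1 + ‖y‖ ^ 2) * ((√(1 + ‖y‖ ^ 2))⁻¹ * inner ℝ y v) = 0
  field_simp
  ring

/-- A vector orthogonal to `x` is the image of its horizontal part by the differential of the
chart. -/
theorem chartDeriv_fst (y : E) (Z : Mink n) (hZ : minkInner (hypPoint y).1 Z = 0) :
    chartDeriv y Z.1 = Z := by
  have h : √(1 + ‖y‖ ^ 2) ≠ 0 := (Real.sqrt_pos.2 (by positivity)).ne'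
  change inner ℝ y Z.1 - √(1 + ‖y‖ ^ 2) * Z.2 = 0 at hZ
  rw [chartDeriv_apply]
  apply Prod.ext
  · rfl
  · change (√(1 + ‖y‖ ^ 2))⁻¹ * inner ℝ y Z.1 = Z.2
    rw [sub_eq_zero.1 hZ]
    field_simp

theorem minkInner_chartDeriv_pos (y v : E) (hv : v ≠ 0) :
    0 < minkInner (chartDeriv y v) (chartDeriv y v) := by
  have h0 : (0 : ℝ) < 1 + ‖y‖ ^ 2 := by positivity
  have hv' : 0 < ‖v‖ ^ 2 := by positivity
  simp only [chartDeriv_apply, minkInner, real_inner_self_eq_norm_sq]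
  have h1 : (√(1 + ‖y‖ ^ 2))⁻¹ * inner ℝ y v * ((√(1 + ‖y‖ ^ 2))⁻¹ * inner ℝ y v)
      = (inner ℝ y v) ^ 2 / (1 + ‖y‖ ^ 2) := by
    rw [← Real.sq_sqrt h0.le, Real.sqrt_sq (Real.sqrt_nonneg _)]
    ring
  have h2 : (inner ℝ y v) ^ 2 ≤ ‖y‖ ^ 2 * ‖v‖ ^ 2 := by
    rw [← mul_pow]
    exact sq_le_sq.2 (by rw [abs_of_nonneg (by positivity : 0 ≤ ‖y‖ * ‖v‖)]
                         exact abs_real_inner_le_norm y v)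
  rw [h1, sub_pos, div_lt_iff₀ h0]
  nlinarith

/-- The hyperbolic gradient of the height function, an ambient vector tangent at `x`. -/
noncomputable def heightGrad (o : Hyp n) (y : E) : Mink n :=
  height o (hypPoint y) • (hypPoint y).1 - o.1

theorem minkInner_hypPoint_heightGrad (o : Hyp n) (y : E) :
    minkInner (hypPoint y).1 (heightGrad o y) = 0 := by
  rw [heightGrad, minkInner_sub_right, minkInner_smul_right, Hyp.inner_self, height,
    minkInner_comm o.1]
  ring

theorem chartDeriv_heightGrad (o : Hyp n) (y : E) :
    chartDeriv y (heightGrad o y).1 = heightGrad o y :=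
  chartDeriv_fst y _ (minkInner_hypPoint_heightGrad o y)

/-- The differential of the height function, read in the chart. -/
noncomputable def heightDeriv (o : Hyp n) (y : E) : E →L[ℝ] ℝ :=
  -(minkForm o.1).comp (chartDeriv y)

theorem heightDeriv_apply (o : Hyp n) (y v : E) :
    heightDeriv o y v = -minkInner o.1 (chartDeriv y v) := by
  simp [heightDeriv, minkForm_apply]

theorem hasFDerivAt_height (o : Hyp n) (y : E) :
    HasFDerivAt (fun y : E => height o (hypPoint y)) (heightDeriv o y) y := by
  have h := ((minkForm o.1).hasFDerivAt.comp y (hasFDerivAt_hypPoint y)).neg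
  refine h.congr_of_eventuallyEq (Eventually.of_forall fun z => ?_)
  simp [height, minkForm_apply]

theorem contDiff_height (o : Hyp n) : ContDiff ℝ ∞ (fun y : E => height o (hypPoint y)) := by
  have h : (fun y : E => height o (hypPoint y))
      = fun y : E => -(minkForm o.1) ((hypPoint y).1) := by
    funext y
    simp [height, minkForm_apply]
  rw [h]
  exact ((minkForm o.1).contDiff.comp contDiff_hypPoint).neg

theorem heightDeriv_heightGrad (o : Hyp n) (y : E) :
    heightDeriv o y (heightGrad o y).1 = height o (hypPoint y) ^ 2 - 1 := by
  rw [heightDeriv_apply, chartDeriv_heightGrad, heightGrad, minkInner_sub_right,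
    minkInner_smul_right, Hyp.inner_self, height]
  ring

/-- The Cauchy–Schwarz inequality `dt(v)² ≤ |∇t|² |v|²` in the tangent space of the
hyperboloid. -/
theorem heightDeriv_sq_le (o : Hyp n) (y v : E) :
    heightDeriv o y v ^ 2
      ≤ (height o (hypPoint y) ^ 2 - 1) * minkInner (chartDeriv y v) (chartDeriv y v) := by
  rcases eq_or_ne v 0 with rfl | hv
  · simp [minkInner]
  have hp := minkInner_chartDeriv_pos y v hv
  set p := minkInner (chartDeriv y v) (chartDeriv y v) with hp_def
  set q := heightDeriv o y v with hq_def
  set Z := (heightGrad o y).1 with hZ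
  have hgu : minkInner (chartDeriv y v) (heightGrad o y) = q := by
    rw [heightGrad, minkInner_sub_right, minkInner_smul_right, minkInner_comm _ (hypPoint y).1,
      minkInner_hypPoint_chartDeriv, minkInner_comm _ o.1, hq_def, heightDeriv_apply]
    ring
  have hgg : minkInner (heightGrad o y) (heightGrad o y) = height o (hypPoint y) ^ 2 - 1 := by
    rw [← heightDeriv_heightGrad, heightDeriv_apply, chartDeriv_heightGrad]
    conv_lhs => enter [1]; rw [heightGrad]
    rw [minkInner_sub_left, minkInner_smul_left, minkInner_hypPoint_heightGrad]
    ring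
  have hnn : 0 ≤ minkInner (chartDeriv y (p • Z - q • v)) (chartDeriv y (p • Z - q • v)) := by
    rcases eq_or_ne (p • Z - q • v) 0 with h | h
    · simp [h, minkInner]
    · exact (minkInner_chartDeriv_pos y _ h).le
  rw [map_sub, map_smul, map_smul, chartDeriv_heightGrad] at hnn
  simp only [minkInner_sub_left, minkInner_sub_right, minkInner_smul_left, minkInner_smul_right,
    hgu, hgg, minkInner_comm (heightGrad o y) (chartDeriv y v), ← hp_def] at hnn
  have h2 : 0 ≤ p * ((height o (hypPoint y) ^ 2 - 1) * p - q ^ 2) := by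
    calc _ ≤ _ := hnn
      _ = _ := by ring
  have := nonneg_of_mul_nonneg_right h2 hp
  linarith

end Chart

/-! ### Geometry of the radial graph of a radial function -/

/-- The Lorentz factor `W = √(1 + β² (t² - 1))` of the normal with slope function `β`. -/
noncomputable def lorentzFactor (β : ℝ → ℝ) (t : ℝ) : ℝ := √(1 + β t ^ 2 * (t ^ 2 - 1))

/-- `e^φ` times the principal curvature along the spheres about `o`, of multiplicity `n - 1`. -/
noncomputable def sphericalCurvature (β : ℝ → ℝ) (t : ℝ) : ℝ := lorentzFactor β t + t * β t

/-- `e^φ` times the principal curvature in the radial direction. -/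
noncomputable def meridianCurvature (β : ℝ → ℝ) (t : ℝ) : ℝ :=
  sphericalCurvature β t + deriv β t * (t ^ 2 - 1)

/-- The square of the operator `F_2` on a radial function with slope function `β`. -/
noncomputable def radialOpSq (n : ℕ) (β : ℝ → ℝ) (t : ℝ) : ℝ :=
  2 / n * (meridianCurvature β t * sphericalCurvature β t)
    + (n - 2) / n * sphericalCurvature β t ^ 2

/-- The function `φ = Φ(t)` of the height `t = cosh r` has slope function `β`: the future unit
normal of its radial graph is `N = (W + t β) x - β o`. Since `β` is an arbitrary smooth function,
this description of radial graphs contains the spacelike condition. -/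
structure IsRadialProfile (β Φ : ℝ → ℝ) : Prop where
  differentiableAt_slope : ∀ t, 1 ≤ t → DifferentiableAt ℝ β t
  contDiffAt : ∀ t, 1 ≤ t → ContDiffAt ℝ ∞ Φ t
  hasDerivAt : ∀ t, 1 ≤ t → HasDerivAt Φ (β t / lorentzFactor β t) t

section Profile

variable {β Φ : ℝ → ℝ} {t : ℝ}

theorem lorentzFactor_arg_pos (ht : 1 ≤ t) : 1 ≤ 1 + β t ^ 2 * (t ^ 2 - 1) := by
  nlinarith [mul_nonneg (sq_nonneg (β t)) (by nlinarith : (0 : ℝ) ≤ t ^ 2 - 1)]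

theorem lorentzFactor_sq (ht : 1 ≤ t) :
    lorentzFactor β t ^ 2 = 1 + β t ^ 2 * (t ^ 2 - 1) :=
  Real.sq_sqrt (by linarith [lorentzFactor_arg_pos (β := β) ht])

theorem one_le_lorentzFactor (ht : 1 ≤ t) : 1 ≤ lorentzFactor β t :=
  Real.one_le_sqrt.2 (lorentzFactor_arg_pos ht)

theorem lorentzFactor_pos (ht : 1 ≤ t) : 0 < lorentzFactor β t :=
  one_pos.trans_le (one_le_lorentzFactor ht)

theorem hasDerivAt_lorentzFactor (hβ : DifferentiableAt ℝ β t) (ht : 1 ≤ t) :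
    HasDerivAt (lorentzFactor β)
      ((β t * deriv β t * (t ^ 2 - 1) + β t ^ 2 * t) / lorentzFactor β t) t := by
  have h1 : HasDerivAt (fun t => 1 + β t ^ 2 * (t ^ 2 - 1))
      (2 * β t * deriv β t * (t ^ 2 - 1) + β t ^ 2 * (2 * t)) t := by
    have h := ((hβ.hasDerivAt.pow 2).mul (((hasDerivAt_id t).pow 2).sub_const 1)).const_add 1
    refine h.congr_deriv ?_
    simp
  have h2 := h1.sqrt (by linarith [lorentzFactor_arg_pos (β := β) ht])
  refine h2.congr_deriv ?_
  have := (lorentzFactor_pos (β := β) ht).ne'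
  change _ / (2 * lorentzFactor β t) = _
  field_simp

/-- The compatibility relation that makes `dN` take values in the tangent space of the graph. -/
theorem hasDerivAt_sphericalCurvature (hβ : DifferentiableAt ℝ β t) (ht : 1 ≤ t) :
    HasDerivAt (sphericalCurvature β)
      (t * deriv β t + β t / lorentzFactor β t * meridianCurvature β t) t := by
  have h := (hasDerivAt_lorentzFactor hβ ht).add ((hasDerivAt_id t).mul hβ.hasDerivAt)
  refine h.congr_deriv ?_
  have := (lorentzFactor_pos (β := β) ht).ne'
  simp only [meridianCurvature, sphericalCurvature, id]
  field_simp
  ring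

end Profile

section Graph

variable {n : ℕ} {β Φ : ℝ → ℝ} (o : Hyp n)

local notation "E" => EuclideanSpace ℝ (Fin n)

/-- The vector field `N = α x - β o`, which is the future unit normal of the graph. -/
noncomputable def profileNormal (β : ℝ → ℝ) (o : Hyp n) (y : E) : Mink n :=
  sphericalCurvature β (height o (hypPoint y)) • (hypPoint y).1
    - β (height o (hypPoint y)) • o.1

theorem IsRadialProfile.hypSmooth (hp : IsRadialProfile β Φ) :
    HypSmooth (fun x => Φ (height o x)) := by
  rw [HypSmooth, contDiff_iff_contDiffAt]
  intro y
  exact (hp.contDiffAt _ (one_le_height o (hypPoint y))).comp y (contDiff_height o).contDiffAt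

theorem isRadial_comp_height (Φ : ℝ → ℝ) : IsRadial o (fun x => Φ (height o x)) :=
  ⟨fun r => Φ (Real.cosh r), fun x => by simp only [cosh_hypDist]⟩

theorem tendsToAtInfinity_comp_height {l : ℝ} (h : Tendsto Φ atTop (𝓝 l)) :
    TendsToAtInfinity o (fun x => Φ (height o x)) l := by
  have h1 : Tendsto (fun x => height o x) (comap (hypDist o) atTop) atTop := by
    refine tendsto_atTop_mono (fun x => ?_) (tendsto_comap (f := hypDist o))
    rw [← cosh_hypDist]
    exact (Real.self_le_sinh_iff.2 (hypDist_nonneg o x)).trans (Real.sinh_lt_cosh _).le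
  exact h.comp h1

theorem IsRadialProfile.fderiv_radialGraph (hp : IsRadialProfile β Φ) (y v : E) :
    fderiv ℝ (radialGraph (fun x => Φ (height o x))) y v
      = Real.exp (Φ (height o (hypPoint y))) • (chartDeriv y v
        + (β (height o (hypPoint y)) / lorentzFactor β (height o (hypPoint y))
          * heightDeriv o y v) • (hypPoint y).1) := by
  have h1 := (hp.hasDerivAt _ (one_le_height o (hypPoint y))).comp_hasFDerivAt y
    (hasFDerivAt_height o y)
  have h2 := h1.exp.smul (hasFDerivAt_hypPoint y)
  have h3 : HasFDerivAt (radialGraph (fun x => Φ (height o x))) _ y := h2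
  rw [h3.fderiv]
  simp only [add_apply, smul_apply,
    ContinuousLinearMap.smulRight_apply, Function.comp_apply, smul_eq_mul, smul_add, smul_smul,
    mul_assoc]

theorem hasFDerivAt_profileNormal (hβ : ∀ t, 1 ≤ t → DifferentiableAt ℝ β t) (y : E) :
    ∃ L : E →L[ℝ] Mink n, HasFDerivAt (profileNormal β o) L y ∧ ∀ v, L v =
      sphericalCurvature β (height o (hypPoint y)) • chartDeriv y v
      + heightDeriv o y v • ((height o (hypPoint y) * deriv β (height o (hypPoint y))
          + β (height o (hypPoint y)) / lorentzFactor β (height o (hypPoint y))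
            * meridianCurvature β (height o (hypPoint y))) • (hypPoint y).1
        - deriv β (height o (hypPoint y)) • o.1) := by
  have ht := one_le_height o (hypPoint y)
  have h1 := (hasDerivAt_sphericalCurvature (hβ _ ht) ht).comp_hasFDerivAt y
    (hasFDerivAt_height o y)
  have h2 := (hβ _ ht).hasDerivAt.comp_hasFDerivAt y (hasFDerivAt_height o y)
  have h3 := (h1.smul (hasFDerivAt_hypPoint y)).sub (h2.smul_const o.1)
  refine ⟨_, h3, fun v => ?_⟩
  simp only [add_apply, smul_apply,
    ContinuousLinearMap.smulRight_apply, Function.comp_apply, smul_eq_mul,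
    sub_apply]
  module

theorem isFutureUnitNormal_profileNormal (hp : IsRadialProfile β Φ) (y : E) :
    IsFutureUnitNormal (fun x => Φ (height o x)) y (profileNormal β o y) := by
  have ht := one_le_height o (hypPoint y)
  have hW := lorentzFactor_pos (β := β) ht
  have hW2 := lorentzFactor_sq (β := β) ht
  have hxx := Hyp.inner_self (hypPoint y)
  have hoo := o.inner_self
  have hox : minkInner o.1 (hypPoint y).1 = -height o (hypPoint y) := by simp [height]
  have hxo := hox
  rw [minkInner_comm] at hxo
  have hNN : minkInner (profileNormal β o y) (profileNormal β o y) = -1 := by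
    simp only [profileNormal, minkInner_sub_left, minkInner_sub_right, minkInner_smul_left,
      minkInner_smul_right, hxx, hoo, hox, hxo, sphericalCurvature]
    linear_combination -hW2
  refine ⟨fun v => ?_, hNN, ?_⟩
  · rw [hp.fderiv_radialGraph o y v]
    have hxu := minkInner_hypPoint_chartDeriv y v
    have hou : minkInner o.1 (chartDeriv y v) = -heightDeriv o y v := by
      rw [heightDeriv_apply, neg_neg]
    simp only [profileNormal, minkInner_sub_left, minkInner_add_right, minkInner_smul_left,
      minkInner_smul_right, hxx, hox, hxu, hou, sphericalCurvature]
    field_simp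
    ring
  · apply snd_pos_of_minkInner_neg _ (hypPoint y) hNN
    simp only [profileNormal, minkInner_sub_left, minkInner_smul_left, hxx, hox,
      sphericalCurvature]
    linarith

/-- A vector orthogonal to a point `x` of the hyperboloid and to its tangent space vanishes. -/
theorem eq_zero_of_forall_minkInner_eq_zero (y : E) (ν : Mink n)
    (h1 : minkInner (hypPoint y).1 ν = 0) (h2 : ∀ v, minkInner ν (chartDeriv y v) = 0) :
    ν = 0 := by
  have h3 := h2 ν.1
  rw [chartDeriv_fst y ν h1] at h3
  have h4 : ν.1 = 0 := by
    by_contra hne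
    have := minkInner_chartDeriv_pos y ν.1 hne
    rw [chartDeriv_fst y ν h1] at this
    linarith
  rw [← chartDeriv_fst y ν h1, h4, map_zero]

theorem futureNormal_eq (hp : IsRadialProfile β Φ) :
    futureNormal (fun x => Φ (height o x)) = profileNormal β o := by
  funext y
  have hex : ∃ ν, IsFutureUnitNormal (fun x => Φ (height o x)) y ν :=
    ⟨_, isFutureUnitNormal_profileNormal o hp y⟩
  rw [futureNormal, dif_pos hex]
  obtain ⟨hν1, hν2, hν3⟩ := hex.choose_spec
  obtain ⟨hN1, hN2, hN3⟩ := isFutureUnitNormal_profileNormal o hp y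
  set ν := hex.choose
  set N := profileNormal β o y with hN
  have hcν : 1 ≤ -minkInner ν (hypPoint y).1 := one_le_height ⟨ν, hν2, hν3⟩ (hypPoint y)
  have hcN : 1 ≤ -minkInner N (hypPoint y).1 := one_le_height ⟨N, hN2, hN3⟩ (hypPoint y)
  have key : ∀ M : Mink n,
      (∀ v, minkInner M (fderiv ℝ (radialGraph (fun x => Φ (height o x))) y v) = 0) →
      ∀ v, minkInner M (chartDeriv y v)
        = -(β (height o (hypPoint y)) / lorentzFactor β (height o (hypPoint y))
          * heightDeriv o y v) * minkInner M (hypPoint y).1 := by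
    intro M hM v
    have h := hM v
    rw [hp.fderiv_radialGraph o y v, minkInner_smul_right, minkInner_add_right,
      minkInner_smul_right] at h
    have := (mul_eq_zero.1 h).resolve_left (Real.exp_pos _).ne'
    linarith
  -- The two normals are proportional, and the normalization determines the factor.
  have hprop : minkInner N (hypPoint y).1 • ν - minkInner ν (hypPoint y).1 • N = 0 := by
    apply eq_zero_of_forall_minkInner_eq_zero y
    · rw [minkInner_comm]
      simp only [minkInner_sub_left, minkInner_smul_left]
      ring
    · intro v
      simp only [minkInner_sub_left, minkInner_smul_left, key _ hν1, key _ hN1]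
      ring
  have hprop' := sub_eq_zero.1 hprop
  have hsq : minkInner N (hypPoint y).1 ^ 2 = minkInner ν (hypPoint y).1 ^ 2 := by
    have h := congrArg (fun Z => minkInner Z Z) hprop'
    simp only [minkInner_smul_left, minkInner_smul_right, hν2, hN2] at h
    linarith
  have heq : minkInner N (hypPoint y).1 = minkInner ν (hypPoint y).1 := by
    nlinarith
  rw [heq] at hprop'
  exact smul_right_injective _ (by linarith : minkInner ν (hypPoint y).1 ≠ 0) hprop'

theorem IsRadialProfile.isSpacelike (hp : IsRadialProfile β Φ) :
    IsSpacelike (fun x => Φ (height o x)) := by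
  intro y v hv
  have ht := one_le_height o (hypPoint y)
  have hW := lorentzFactor_pos (β := β) ht
  have hW2 := lorentzFactor_sq (β := β) ht
  have hcs := heightDeriv_sq_le o y v
  have hpos := minkInner_chartDeriv_pos y v hv
  have hxu := minkInner_hypPoint_chartDeriv y v
  have hux := hxu
  rw [minkInner_comm] at hux
  have he := Real.exp_pos (Φ (height o (hypPoint y)))
  rw [hp.fderiv_radialGraph o y v]
  simp only [minkInner_smul_left, minkInner_smul_right, minkInner_add_left, minkInner_add_right,
    hxu, hux, Hyp.inner_self]
  generalize Real.exp (Φ (height o (hypPoint y))) = e at he ⊢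
  set b := β (height o (hypPoint y))
  set W := lorentzFactor β (height o (hypPoint y))
  set p := minkInner (chartDeriv y v) (chartDeriv y v)
  set q := heightDeriv o y v
  have h1 : 0 < (W ^ 2 * p - b ^ 2 * q ^ 2) / W ^ 2 := by
    apply div_pos _ (by positivity)
    rw [hW2]
    nlinarith [mul_le_mul_of_nonneg_left hcs (sq_nonneg b)]
  have h2 : (W ^ 2 * p - b ^ 2 * q ^ 2) / W ^ 2 = p - (b / W * q) ^ 2 := by
    field_simp
  rw [h2] at h1
  refine (mul_pos (pow_pos he 2) h1).trans_eq ?_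
  ring

theorem IsRadialProfile.isStrictlyConvexGraph (hp : IsRadialProfile β Φ)
    (hα : ∀ t, 1 ≤ t → 0 < sphericalCurvature β t)
    (hκ : ∀ t, 1 ≤ t → 0 < meridianCurvature β t) :
    IsStrictlyConvexGraph (fun x => Φ (height o x)) := by
  intro y v hv
  have ht := one_le_height o (hypPoint y)
  have hW := lorentzFactor_pos (β := β) ht
  have hW2 := lorentzFactor_sq (β := β) ht
  have hcs := heightDeriv_sq_le o y v
  have hpos := minkInner_chartDeriv_pos y v hv
  have hxu := minkInner_hypPoint_chartDeriv y v
  have hux := hxu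
  rw [minkInner_comm] at hux
  have hou : minkInner o.1 (chartDeriv y v) = -heightDeriv o y v := by
    rw [heightDeriv_apply, neg_neg]
  have hox : minkInner o.1 (hypPoint y).1 = -height o (hypPoint y) := by simp [height]
  have hα' := hα _ ht
  have hκ' := hκ _ ht
  obtain ⟨L, hL, hLv⟩ := hasFDerivAt_profileNormal o hp.differentiableAt_slope y
  rw [futureNormal_eq o hp, hL.fderiv, hLv, hp.fderiv_radialGraph o y v]
  simp only [minkInner_smul_left, minkInner_smul_right, minkInner_add_left, minkInner_add_right,
    minkInner_sub_left, hxu, hux, hou, hox, Hyp.inner_self]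
  apply mul_pos (Real.exp_pos _)
  simp only [meridianCurvature] at hκ' ⊢
  set s := height o (hypPoint y)
  set b := β s
  set b' := deriv β s
  set W := lorentzFactor β s
  set a := sphericalCurvature β s
  set p := minkInner (chartDeriv y v) (chartDeriv y v)
  set q := heightDeriv o y v
  -- The form is affine in `q²`, which ranges over `[0, (t² - 1) p]`: it suffices to look at the
  -- two end points, which are the two principal directions.
  have h1 : 0 < (a * p * W ^ 2 + (b' - a * b ^ 2) * q ^ 2) / W ^ 2 := by
    apply div_pos _ (by positivity)
    have h0 := mul_pos hα' hpos
    have h2 : 0 < (a + b' * (s ^ 2 - 1)) * p := mul_pos hκ' hpos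
    rcases le_or_gt 0 (b' - a * b ^ 2) with h | h
    · have := mul_nonneg h (sq_nonneg q)
      positivity
    · have h3 := mul_le_mul_of_nonneg_left hcs (neg_pos.2 h).le
      have h4 : a * p * W ^ 2 = a * p + a * p * (b ^ 2 * (s ^ 2 - 1)) := by rw [hW2]; ring
      rw [h4]
      linarith
  refine h1.trans_eq ?_
  field_simp
  linear_combination (-b' * q ^ 2) * hW2

theorem curvatureEndo_eq (hp : IsRadialProfile β Φ) (y : E) :
    curvatureEndo (fun x => Φ (height o x)) y
      = (Real.exp (-Φ (height o (hypPoint y))) * sphericalCurvature β (height o (hypPoint y)))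
          • (1 : Module.End ℝ E)
        + (heightDeriv o y : E →ₗ[ℝ] ℝ).smulRight
          ((Real.exp (-Φ (height o (hypPoint y))) * deriv β (height o (hypPoint y)))
            • (heightGrad o y).1) := by
  obtain ⟨L, hL, hLv⟩ := hasFDerivAt_profileNormal o hp.differentiableAt_slope y
  have hinj : LinearMap.ker
      (fderiv ℝ (radialGraph fun x => Φ (height o x)) y : E →ₗ[ℝ] Mink n) = ⊥ := by
    rw [LinearMap.ker_eq_bot']
    intro v hv
    by_contra hne
    have h := hp.isSpacelike o y v hne
    have hv' : fderiv ℝ (radialGraph fun x => Φ (height o x)) y v = 0 := hv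
    simp [hv', minkInner] at h
  ext1 v
  rw [curvatureEndo, LinearMap.comp_apply, futureNormal_eq o hp]
  set S := (Real.exp (-Φ (height o (hypPoint y)))
      * sphericalCurvature β (height o (hypPoint y))) • (1 : Module.End ℝ E)
    + (heightDeriv o y : E →ₗ[ℝ] ℝ).smulRight
      ((Real.exp (-Φ (height o (hypPoint y))) * deriv β (height o (hypPoint y)))
        • (heightGrad o y).1) with hS
  have hdN : (fderiv ℝ (profileNormal β o) y : E →ₗ[ℝ] Mink n) v
      = (fderiv ℝ (radialGraph fun x => Φ (height o x)) y : E →ₗ[ℝ] Mink n) (S v) := by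
    change fderiv ℝ (profileNormal β o) y v
      = fderiv ℝ (radialGraph fun x => Φ (height o x)) y (S v)
    have hSv : S v = Real.exp (-Φ (height o (hypPoint y)))
        • (sphericalCurvature β (height o (hypPoint y)) • v
          + (heightDeriv o y v * deriv β (height o (hypPoint y))) • (heightGrad o y).1) := by
      simp only [hS, LinearMap.add_apply, LinearMap.smul_apply, Module.End.one_apply,
        LinearMap.smulRight_apply, ContinuousLinearMap.coe_coe]
      module
    rw [hL.fderiv, hLv, hSv, map_smul, hp.fderiv_radialGraph, smul_smul, ← Real.exp_add,
      neg_add_cancel, Real.exp_zero, one_smul, map_add, map_smul, map_smul, map_add, map_smul,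
      map_smul, chartDeriv_heightGrad, heightDeriv_heightGrad, heightGrad, meridianCurvature]
    simp only [smul_eq_mul]
    module
  rw [hdN, LinearMap.leftInverse_apply_of_inj hinj]

theorem IsRadialProfile.radialOp_eq (hn : 2 ≤ n) (hp : IsRadialProfile β Φ) (x : Hyp n) :
    radialOp 2 (fun x => Φ (height o x)) x = √(radialOpSq n β (height o x)) := by
  have hx := hypPoint_fst x
  rw [radialOp, meanCurvature, principalCurvatures, curvatureEndo_eq o hp,
    esymm_two_roots_charpoly hn, ContinuousLinearMap.coe_coe, map_smul, heightDeriv_heightGrad, hx]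
  have hexp : Real.exp (-Φ (height o x)) * Real.exp (Φ (height o x)) = 1 := by
    rw [← Real.exp_add]
    simp
  have hsq : Real.exp (Φ (height o x)) = √(Real.exp (Φ (height o x)) ^ 2) :=
    (Real.sqrt_sq (Real.exp_pos _).le).symm
  rw [show (1 / ((2 : ℕ) : ℝ)) = 1 / 2 by norm_num, ← Real.sqrt_eq_rpow]
  conv_lhs => enter [1]; rw [hsq]
  rw [← Real.sqrt_mul (sq_nonneg _)]
  congr 1
  rw [radialOpSq, meridianCurvature]
  generalize Real.exp (Φ (height o x)) = e at hexp ⊢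
  generalize Real.exp (-Φ (height o x)) = e' at hexp ⊢
  have h2 : e' ^ 2 * e ^ 2 = 1 := by rw [← mul_pow, hexp, one_pow]
  simp only [smul_eq_mul]
  linear_combination (2 / n * ((sphericalCurvature β (height o x) + deriv β (height o x)
    * (height o x ^ 2 - 1)) * sphericalCurvature β (height o x))
    + (n - 2) / n * sphericalCurvature β (height o x) ^ 2) * h2

end Graph

/-! ### Potentials and a damped linear equation -/

theorem monotoneOn_Ici_of_hasDerivAt_nonneg {f f' : ℝ → ℝ} {a : ℝ}
    (hf : ∀ t, a ≤ t → HasDerivAt f (f' t) t) (hf' : ∀ t, a ≤ t → 0 ≤ f' t) :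
    MonotoneOn f (Set.Ici a) := by
  apply monotoneOn_of_deriv_nonneg (convex_Ici a)
  · exact fun t ht => (hf t ht).continuousAt.continuousWithinAt
  · rw [interior_Ici]
    exact fun t ht => (hf t (le_of_lt ht)).differentiableAt.differentiableWithinAt
  · rw [interior_Ici]
    intro t ht
    rw [(hf t (le_of_lt ht)).deriv]
    exact hf' t (le_of_lt ht)

theorem hasDerivAt_integral_of_continuousOn_Ioi {f : ℝ → ℝ} {a : ℝ} (ha : a < 1)
    (hf : ContinuousOn f (Set.Ioi a)) {t : ℝ} (ht : a < t) :
    HasDerivAt (fun t => ∫ u in (1 : ℝ)..t, f u) (f t) t := by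
  have hsub : Set.uIcc 1 t ⊆ Set.Ioi a := by
    intro u hu
    exact (lt_min ha ht).trans_le hu.1
  exact intervalIntegral.integral_hasDerivAt_right (hf.mono hsub).intervalIntegrable
    (hf.stronglyMeasurableAtFilter isOpen_Ioi t ht)
    (hf.continuousAt (isOpen_Ioi.mem_nhds ht))

theorem contDiffOn_integral_Ioi {f : ℝ → ℝ} {a : ℝ} (ha : a < 1)
    (hf : ContDiffOn ℝ ∞ f (Set.Ioi a)) :
    ContDiffOn ℝ ∞ (fun t => ∫ u in (1 : ℝ)..t, f u) (Set.Ioi a) := by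
  have hd : ∀ t ∈ Set.Ioi a, HasDerivAt (fun t => ∫ u in (1 : ℝ)..t, f u) (f t) t :=
    fun t ht => hasDerivAt_integral_of_continuousOn_Ioi ha hf.continuousOn ht
  rw [contDiffOn_infty_iff_deriv_of_isOpen isOpen_Ioi]
  exact ⟨fun t ht => (hd t ht).differentiableAt.differentiableWithinAt,
    hf.congr fun t ht => (hd t ht).deriv⟩

/-- A nonnegative slope function with a bounded antiderivative integrates to a radial function
vanishing at infinity, because `0 ≤ dΦ/dt = β / W ≤ β`. -/
theorem exists_isRadialProfile {β G G' : ℝ → ℝ} {C : ℝ}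
    (hβ : ContDiffOn ℝ ∞ β (Set.Ioi 0)) (h0 : ∀ t, 1 ≤ t → 0 ≤ β t)
    (hG : ∀ t, 1 ≤ t → HasDerivAt G (G' t) t) (hle : ∀ t, 1 ≤ t → β t ≤ G' t)
    (hC : ∀ t, 1 ≤ t → G t ≤ C) :
    ∃ Φ, IsRadialProfile β Φ ∧ Tendsto Φ atTop (𝓝 0) := by
  -- The Lorentz factor makes sense slightly to the left of `t = 1`.
  obtain ⟨a, ha0, ha1, ha⟩ : ∃ a : ℝ, 0 ≤ a ∧ a < 1 ∧
      ∀ t, a < t → 0 < 1 + β t ^ 2 * (t ^ 2 - 1) := by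
    have hc : ContinuousAt (fun t => 1 + β t ^ 2 * (t ^ 2 - 1)) 1 := by
      have := hβ.continuousOn.continuousAt (isOpen_Ioi.mem_nhds (by norm_num : (1 : ℝ) ∈ Set.Ioi 0))
      fun_prop
    have hev : ∀ᶠ t in 𝓝 (1 : ℝ), 0 < 1 + β t ^ 2 * (t ^ 2 - 1) :=
      hc.eventually (lt_mem_nhds (by norm_num))
    obtain ⟨ε, hε, h⟩ := Metric.eventually_nhds_iff.1 hev
    refine ⟨max 0 (1 - ε), le_max_left _ _, max_lt one_pos (by linarith), fun t ht => ?_⟩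
    rcases le_or_gt 1 t with h1 | h1
    · linarith [lorentzFactor_arg_pos (β := β) h1]
    · apply h
      rw [Real.dist_eq, abs_sub_lt_iff]
      have := (le_max_right 0 (1 - ε)).trans_lt ht
      constructor <;> linarith
  have hsub : Set.Ioi a ⊆ Set.Ioi 0 := Set.Ioi_subset_Ioi ha0
  have hm : ContDiffOn ℝ ∞ (fun t => β t / lorentzFactor β t) (Set.Ioi a) := by
    apply (hβ.mono hsub).div
    · apply ContDiffOn.sqrt
      · exact contDiffOn_const.add (((hβ.mono hsub).pow 2).mul
          ((contDiffOn_id.pow 2).sub contDiffOn_const))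
      · exact fun t ht => (ha t ht).ne'
    · exact fun t ht => (Real.sqrt_pos.2 (ha t ht)).ne'
  set F : ℝ → ℝ := fun t => ∫ u in (1 : ℝ)..t, β u / lorentzFactor β u with hF
  have hFs : ContDiffOn ℝ ∞ F (Set.Ioi a) := contDiffOn_integral_Ioi ha1 hm
  have hFd : ∀ t, 1 ≤ t → HasDerivAt F (β t / lorentzFactor β t) t := fun t ht =>
    hasDerivAt_integral_of_continuousOn_Ioi ha1 hm.continuousOn (ha1.trans_le ht)
  have hmono : MonotoneOn F (Set.Ici 1) := monotoneOn_Ici_of_hasDerivAt_nonneg hFd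
    fun t ht => div_nonneg (h0 t ht) (lorentzFactor_pos ht).le
  have hmono2 : MonotoneOn (fun t => G t - F t) (Set.Ici 1) :=
    monotoneOn_Ici_of_hasDerivAt_nonneg (fun t ht => (hG t ht).sub (hFd t ht)) fun t ht => by
      have := div_le_self (h0 t ht) (one_le_lorentzFactor (β := β) ht)
      linarith [hle t ht]
  have hbound : ∀ t, 1 ≤ t → F t ≤ C - G 1 + F 1 := fun t ht => by
    have := hmono2 (Set.mem_Ici.2 le_rfl) ht ht
    simp only at this
    linarith [hC t ht]
  have hlim : Tendsto (fun t => F (max 1 t)) atTop (𝓝 (⨆ t, F (max 1 t))) := by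
    apply tendsto_atTop_ciSup
    · intro s t hst
      exact hmono (Set.mem_Ici.2 (le_max_left _ _)) (Set.mem_Ici.2 (le_max_left _ _))
        (max_le_max_left 1 hst)
    · refine ⟨C - G 1 + F 1, ?_⟩
      rintro _ ⟨t, rfl⟩
      exact hbound _ (le_max_left _ _)
  set l := ⨆ t, F (max 1 t)
  have hlim2 : Tendsto F atTop (𝓝 l) := by
    refine hlim.congr' ?_
    filter_upwards [eventually_ge_atTop 1] with t ht
    rw [max_eq_right ht]
  refine ⟨fun t => F t - l, ⟨fun t ht => ?_, fun t ht => ?_, fun t ht => ?_⟩, ?_⟩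
  · exact (hβ.contDiffAt (isOpen_Ioi.mem_nhds (one_pos.trans_le ht))).differentiableAt (by simp)
  · exact (hFs.contDiffAt (isOpen_Ioi.mem_nhds (ha1.trans_le ht))).sub contDiffAt_const
  · exact (hFd t ht).sub_const l
  · simpa using hlim2.sub_const l

theorem IsRadialProfile.neg {β Φ : ℝ → ℝ} (hp : IsRadialProfile β Φ) :
    IsRadialProfile (fun t => -β t) (fun t => -Φ t) := by
  refine ⟨fun t ht => (hp.differentiableAt_slope t ht).neg, fun t ht => (hp.contDiffAt t ht).neg,
    fun t ht => ?_⟩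
  refine (hp.hasDerivAt t ht).neg.congr_deriv ?_
  simp only [lorentzFactor, neg_sq, neg_div]

/-- The solution of `β' = -3β / (2 (t + L)) + δ / t²` with `β(1) = A / (1 + L)^{3/2}`. With
`t = cosh r` and `σ = β sinh r`, it satisfies `dσ/dr + σ/2 ≥ tanh² r · δ`. -/
noncomputable def dampedSlope (L A : ℝ) (δ : ℝ → ℝ) (t : ℝ) : ℝ :=
  (t + L) ^ (-(3 / 2) : ℝ) * (A + ∫ u in (1 : ℝ)..t, (u + L) ^ (3 / 2 : ℝ) * (δ u / u ^ 2))

section Damped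

variable {L A : ℝ} {δ : ℝ → ℝ} {t : ℝ}

theorem contDiffOn_damped_integrand (hL : 0 ≤ L) (hδ : ContDiff ℝ ∞ δ) :
    ContDiffOn ℝ ∞ (fun u => (u + L) ^ (3 / 2 : ℝ) * (δ u / u ^ 2)) (Set.Ioi 0) := by
  apply ContDiffOn.mul
  · apply ContDiffOn.rpow_const_of_ne (contDiffOn_id.add contDiffOn_const)
    intro u hu
    have : 0 < u := hu
    simp only [id]
    positivity
  · apply hδ.contDiffOn.div (contDiffOn_id.pow 2)
    intro u hu
    exact pow_ne_zero 2 (ne_of_gt hu)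

theorem contDiffOn_dampedSlope (hL : 0 ≤ L) (hδ : ContDiff ℝ ∞ δ) :
    ContDiffOn ℝ ∞ (dampedSlope L A δ) (Set.Ioi 0) := by
  apply ContDiffOn.mul
  · apply ContDiffOn.rpow_const_of_ne (contDiffOn_id.add contDiffOn_const)
    intro u hu
    have : 0 < u := hu
    simp only [id]
    positivity
  · exact contDiffOn_const.add
      (contDiffOn_integral_Ioi one_pos (contDiffOn_damped_integrand hL hδ))

theorem hasDerivAt_dampedSlope (hL : 0 ≤ L) (hδ : ContDiff ℝ ∞ δ) (ht : 0 < t) :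
    HasDerivAt (dampedSlope L A δ)
      (-(3 / 2) * dampedSlope L A δ t / (t + L) + δ t / t ^ 2) t := by
  have htL : 0 < t + L := by positivity
  have h1 := ((hasDerivAt_id t).add_const L).rpow_const (p := (-(3 / 2) : ℝ)) (Or.inl htL.ne')
  have h2 := (hasDerivAt_integral_of_continuousOn_Ioi one_pos
    (contDiffOn_damped_integrand hL hδ).continuousOn ht).const_add A
  refine (h1.mul h2).congr_deriv ?_
  have e1 : (t + L) ^ (-(3 / 2) - 1 : ℝ) = (t + L) ^ (-(3 / 2) : ℝ) / (t + L) := by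
    rw [Real.rpow_sub htL, Real.rpow_one]
  have e2 : (t + L) ^ (-(3 / 2) : ℝ) * (t + L) ^ (3 / 2 : ℝ) = 1 := by
    rw [← Real.rpow_add htL]
    norm_num
  simp only [id, dampedSlope]
  rw [e1]
  linear_combination (δ t / t ^ 2) * e2

theorem dampedSlope_lower (hL : 0 ≤ L) (hδ0 : ∀ t, 0 ≤ δ t) (ht : 1 ≤ t) :
    (t + L) ^ (-(3 / 2) : ℝ) * A ≤ dampedSlope L A δ t := by
  have htL : 0 < t + L := by positivity
  apply mul_le_mul_of_nonneg_left _ (Real.rpow_nonneg htL.le _)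
  have : 0 ≤ ∫ u in (1 : ℝ)..t, (u + L) ^ (3 / 2 : ℝ) * (δ u / u ^ 2) := by
    apply intervalIntegral.integral_nonneg ht
    intro u hu
    have : 0 ≤ u + L := by linarith [hu.1]
    exact mul_nonneg (Real.rpow_nonneg this _) (div_nonneg (hδ0 u) (sq_nonneg u))
  linarith

theorem dampedSlope_nonneg (hL : 0 ≤ L) (hA : 0 ≤ A) (hδ0 : ∀ t, 0 ≤ δ t) (ht : 1 ≤ t) :
    0 ≤ dampedSlope L A δ t := by
  have htL : 0 ≤ t + L := by positivity
  exact (mul_nonneg (Real.rpow_nonneg htL _) hA).trans (dampedSlope_lower hL hδ0 ht)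

/-- The equation gives `d/dt (-2 (t + L) β) = β - 2 (t + L) δ / t²`, so that the integral of `β`
is bounded by that of `δ / t`. -/
theorem exists_isRadialProfile_dampedSlope (hL : 0 ≤ L) (hA : 0 ≤ A) (hδ : ContDiff ℝ ∞ δ)
    (hδ0 : ∀ t, 0 ≤ δ t) (hint : IntegrableOn (fun t => δ t / t) (Set.Ioi 1)) :
    ∃ Φ, IsRadialProfile (dampedSlope L A δ) Φ ∧ Tendsto Φ atTop (𝓝 0) := by
  have hcont : ContinuousOn (fun t => δ t / t) (Set.Ioi 0) :=
    hδ.continuous.continuousOn.div continuousOn_id fun t ht => ne_of_gt ht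
  refine exists_isRadialProfile
    (G := fun t => -2 * ((t + L) * dampedSlope L A δ t) + 2 * (1 + L) * ∫ u in (1 : ℝ)..t, δ u / u)
    (G' := fun t => dampedSlope L A δ t + 2 * L * (t - 1) * δ t / t ^ 2)
    (C := 2 * (1 + L) * ∫ u in Set.Ioi (1 : ℝ), δ u / u)
    (contDiffOn_dampedSlope hL hδ) (fun t ht => dampedSlope_nonneg hL hA hδ0 ht)
    (fun t ht => ?_) (fun t ht => ?_) (fun t ht => ?_)
  · have ht0 : 0 < t := one_pos.trans_le ht
    have htL : 0 < t + L := by positivity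
    have h1 := (((hasDerivAt_id t).add_const L).mul
      (hasDerivAt_dampedSlope (A := A) hL hδ ht0)).const_mul (-2)
    have h2 := (hasDerivAt_integral_of_continuousOn_Ioi one_pos hcont ht0).const_mul (2 * (1 + L))
    refine (h1.add h2).congr_deriv ?_
    simp only [id]
    field_simp
    ring
  · have : 0 ≤ 2 * L * (t - 1) * δ t / t ^ 2 :=
      div_nonneg (mul_nonneg (mul_nonneg (by positivity) (by linarith)) (hδ0 t)) (sq_nonneg t)
    linarith
  · have hb : 0 ≤ (t + L) * dampedSlope L A δ t :=
      mul_nonneg (by linarith) (dampedSlope_nonneg hL hA hδ0 ht)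
    have hi : ∫ u in (1 : ℝ)..t, δ u / u ≤ ∫ u in Set.Ioi (1 : ℝ), δ u / u := by
      rw [intervalIntegral.integral_of_le ht]
      apply setIntegral_mono_set hint
      · filter_upwards [ae_restrict_mem measurableSet_Ioi] with u hu
        exact div_nonneg (hδ0 u) (one_pos.trans hu).le
      · exact Set.Ioc_subset_Ioi_self.eventuallyLE
    have := mul_le_mul_of_nonneg_left hi (by positivity : 0 ≤ 2 * (1 + L))
    linarith

end Damped

/-! ### Radial sub- and supersolutions -/

theorem exists_sqrt_sq_sub_one {t : ℝ} (ht : 1 ≤ t) :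
    ∃ s : ℝ, 0 ≤ s ∧ s ≤ t ∧ s ^ 2 = t ^ 2 - 1 := by
  have h : 0 ≤ t ^ 2 - 1 := by nlinarith
  refine ⟨√(t ^ 2 - 1), Real.sqrt_nonneg _, ?_, Real.sq_sqrt h⟩
  rw [Real.sqrt_le_left (by linarith)]
  linarith

/-- A convex combination with weights `2 / n` and `(n - 2) / n`. -/
theorem two_div_add_sub_two_div {n : ℕ} (hn : 2 ≤ n) :
    (0 : ℝ) ≤ 2 / n ∧ (0 : ℝ) ≤ (n - 2) / n ∧ (2 : ℝ) / n + (n - 2) / n = 1 := by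
  have h2 : (2 : ℝ) ≤ n := by exact_mod_cast hn
  have h0 : (0 : ℝ) < n := by linarith
  refine ⟨by positivity, div_nonneg (by linarith) h0.le, ?_⟩
  field_simp
  ring

/-- With `σ = β sinh r`, the bounds `k₁ ≥ W - σ / 2 + δ tanh² r` and `k₂ ≥ W + σ` suffice for
`k₁ k₂ ≥ 1 + δ tanh² r`. The factor `A` controls the operator near the centre, where no condition
is put on `δ`. -/
theorem exists_radial_subsolution {n : ℕ} (hn : 2 ≤ n) {δ : ℝ → ℝ} (hδ : ContDiff ℝ ∞ δ)
    (hδ0 : ∀ t, 0 ≤ δ t) (hint : IntegrableOn (fun t => δ t / t) (Set.Ioi 1))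
    {A : ℝ} (hA : 2 ≤ A) :
    ∃ β Φ : ℝ → ℝ, IsRadialProfile β Φ ∧ Tendsto Φ atTop (𝓝 0) ∧
      (∀ t, 1 ≤ t → 0 < sphericalCurvature β t) ∧
      (∀ t, 1 ≤ t → 0 < meridianCurvature β t) ∧
      (∀ t, 1 ≤ t → t ≤ 2 → A / 6 ≤ radialOpSq n β t) ∧
      (∀ t, 1 ≤ t → 1 + 2 / n * ((1 - 1 / t ^ 2) * δ t) ≤ radialOpSq n β t) := by
  obtain ⟨Φ, hp, hΦ⟩ := exists_isRadialProfile_dampedSlope (L := 0) (A := A) le_rfl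
    (by linarith) hδ hδ0 hint
  set β := dampedSlope 0 A δ with hβ
  have hb : ∀ t, 1 ≤ t → 0 ≤ β t := fun t ht =>
    dampedSlope_nonneg le_rfl (by linarith) hδ0 ht
  have hd : ∀ t, 1 ≤ t → deriv β t = -(3 / 2) * β t / t + δ t / t ^ 2 := fun t ht => by
    have h := (hasDerivAt_dampedSlope (A := A) le_rfl hδ (one_pos.trans_le ht)).deriv
    rwa [add_zero] at h
  obtain ⟨hw1, hw2, hw3⟩ := two_div_add_sub_two_div hn
  have key : ∀ t, 1 ≤ t → ∃ σ : ℝ, 0 ≤ σ ∧ lorentzFactor β t ^ 2 = 1 + σ ^ 2 ∧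
      lorentzFactor β t + σ ≤ sphericalCurvature β t ∧
      lorentzFactor β t - σ / 2 + (1 - 1 / t ^ 2) * δ t ≤ meridianCurvature β t := by
    intro t ht
    obtain ⟨s, hs0, hst, hs⟩ := exists_sqrt_sq_sub_one ht
    have ht0 : 0 < t := one_pos.trans_le ht
    have hbt := hb t ht
    refine ⟨β t * s, mul_nonneg hbt hs0, ?_, ?_, ?_⟩
    · rw [lorentzFactor_sq ht, mul_pow, hs]
    · rw [sphericalCurvature]
      linarith [mul_le_mul_of_nonneg_left hst hbt]
    · rw [meridianCurvature, sphericalCurvature, hd t ht]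
      have h1 : s ^ 2 / t ≤ s := by
        rw [div_le_iff₀ ht0]
        nlinarith
      have h2 : s ^ 2 / t ≤ t := h1.trans hst
      have h3 : (-(3 / 2) * β t / t + δ t / t ^ 2) * (t ^ 2 - 1)
          = -(3 / 2) * β t * (s ^ 2 / t) + (1 - 1 / t ^ 2) * δ t := by
        rw [hs]
        field_simp
      rw [h3]
      nlinarith [mul_le_mul_of_nonneg_left h1 hbt, mul_le_mul_of_nonneg_left h2 hbt]
  have hδ' : ∀ t, 1 ≤ t → 0 ≤ (1 - 1 / t ^ 2) * δ t := fun t ht => by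
    apply mul_nonneg _ (hδ0 t)
    rw [sub_nonneg, div_le_one (by positivity)]
    nlinarith
  have hhalf : ∀ t, 1 ≤ t → 1 / 2 ≤ meridianCurvature β t := by
    intro t ht
    obtain ⟨σ, hσ, hW, -, hk⟩ := key t ht
    have h1 := one_le_lorentzFactor (β := β) ht
    have h2 : σ ≤ lorentzFactor β t := le_of_sq_le_sq (by linarith) (by linarith)
    linarith [hδ' t ht]
  have hone : ∀ t, 1 ≤ t → 1 ≤ sphericalCurvature β t := by
    intro t ht
    obtain ⟨σ, hσ, hW, ha, -⟩ := key t ht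
    linarith [one_le_lorentzFactor (β := β) ht]
  refine ⟨β, Φ, hp, hΦ, fun t ht => one_pos.trans_le (hone t ht),
    fun t ht => lt_of_lt_of_le (by norm_num) (hhalf t ht), fun t ht ht2 => ?_, fun t ht => ?_⟩
  · have h1 : A / 3 ≤ β t := by
      refine le_trans ?_ (dampedSlope_lower le_rfl hδ0 ht)
      have h2 : (2 : ℝ) ^ (-2 : ℝ) * 2 ^ (1 / 2 : ℝ) ≤ (t + 0) ^ (-(3 / 2) : ℝ) := by
        rw [← Real.rpow_add two_pos, add_zero]
        norm_num
        exact Real.rpow_le_rpow_of_nonpos (by linarith) ht2 (by norm_num)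
      have h3 : (4 / 3 : ℝ) ≤ 2 ^ (1 / 2 : ℝ) := by
        rw [← Real.sqrt_eq_rpow]
        exact Real.le_sqrt_of_sq_le (by norm_num)
      have h4 : (2 : ℝ) ^ (-2 : ℝ) = 1 / 4 := by
        rw [Real.rpow_neg two_pos.le]
        norm_num
      rw [h4] at h2
      nlinarith
    have h2 : A / 3 ≤ sphericalCurvature β t := by
      rw [sphericalCurvature]
      nlinarith [one_le_lorentzFactor (β := β) ht, hb t ht]
    have h3 : A / 6 ≤ meridianCurvature β t * sphericalCurvature β t := by
      nlinarith [hhalf t ht]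
    have h4 : A / 6 ≤ sphericalCurvature β t ^ 2 := by nlinarith [hone t ht]
    calc A / 6 = (2 / n + (n - 2) / n) * (A / 6) := by rw [hw3, one_mul]
      _ ≤ _ := by
        rw [radialOpSq, add_mul]
        exact add_le_add (mul_le_mul_of_nonneg_left h3 hw1) (mul_le_mul_of_nonneg_left h4 hw2)
  · obtain ⟨σ, hσ, hW, ha, hk⟩ := key t ht
    have hW1 := one_le_lorentzFactor (β := β) ht
    have hσW : σ ≤ lorentzFactor β t := le_of_sq_le_sq (by linarith) (by linarith)
    have hd' := hδ' t ht
    have h3 : 1 + (1 - 1 / t ^ 2) * δ t ≤ meridianCurvature β t * sphericalCurvature β t := by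
      refine le_trans ?_ (mul_le_mul hk ha (by linarith) (by linarith [hhalf t ht]))
      nlinarith [mul_nonneg hd' (by linarith : 0 ≤ lorentzFactor β t + σ - 1)]
    have h4 : 1 ≤ sphericalCurvature β t ^ 2 := one_le_pow₀ (hone t ht)
    calc 1 + 2 / n * ((1 - 1 / t ^ 2) * δ t)
        = 2 / n * (1 + (1 - 1 / t ^ 2) * δ t) + (n - 2) / n * 1 := by linear_combination -hw3
      _ ≤ _ := add_le_add (mul_le_mul_of_nonneg_left h3 hw1) (mul_le_mul_of_nonneg_left h4 hw2)

/-- The algebra behind the supersolution: `D = W - σ` satisfies `2 σ D = 1 - D²`. -/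
theorem mul_le_of_damped {W σ d k a : ℝ} (hσ : 0 ≤ σ) (hW : 0 < W) (hW2 : W ^ 2 = 1 + σ ^ 2)
    (hd : 0 ≤ d) (ha : 0 < a) (haW : a ≤ W - σ) (hk0 : 0 ≤ k) (hk : k ≤ W + σ / 2 - d) :
    (d ≤ 1 / 4 → k * a ≤ 1 - d) ∧ (1 ≤ σ → k * a ≤ 4 / 5) := by
  obtain ⟨D, hD⟩ : ∃ D, D = W - σ := ⟨_, rfl⟩
  have hD0 : 0 < D := by linarith
  have hDσ : 2 * σ * D = 1 - D ^ 2 := by rw [hD]; linear_combination hW2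
  have hD1 : D ≤ 1 := by nlinarith [mul_nonneg hσ hD0.le]
  have h1 : k * a ≤ (W + σ / 2 - d) * D := by
    rw [hD]
    exact mul_le_mul hk haW ha.le (hk0.trans hk)
  have h2 : (W + σ / 2 - d) * D = 1 - (1 - D ^ 2) / 4 - d * D := by
    have : W = D + σ := by linarith
    rw [this]
    linear_combination (3 / 4) * hDσ
  refine ⟨fun hd4 => ?_, fun hσ1 => ?_⟩
  · nlinarith [mul_nonneg (by linarith : 0 ≤ 1 / 4 - d) (by linarith : 0 ≤ 1 - D),
      mul_nonneg hD0.le (by linarith : 0 ≤ 1 - D)]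
  · nlinarith [mul_nonneg hd hD0.le, mul_le_mul_of_nonneg_right hσ1 hD0.le]

/-- A damped slope function started close to `1` stays in `[0, 1)`, and stays close to `1` on
a bounded set when `L` is large. -/
theorem dampedSlope_bounds {L η : ℝ} {δ : ℝ → ℝ} (hδ : ContDiff ℝ ∞ δ) (hδ0 : ∀ t, 0 ≤ δ t)
    (hδ1 : ∀ t, δ t ≤ 1 / 4) (hδL : ∀ t, t ≤ L → δ t = 0) (hL : 1 ≤ L) (hη : η ≤ 1)
    (hηL : 1 / L ≤ η) {t : ℝ} (ht : 1 ≤ t) :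
    0 ≤ dampedSlope L ((1 - η) * (1 + L) ^ (3 / 2 : ℝ)) δ t ∧
      dampedSlope L ((1 - η) * (1 + L) ^ (3 / 2 : ℝ)) δ t < 1 ∧
      1 - η - 3 / 2 * (t - 1) / L ≤ dampedSlope L ((1 - η) * (1 + L) ^ (3 / 2 : ℝ)) δ t := by
  have hL0 : 0 < L := one_pos.trans_le hL
  set γ := dampedSlope L ((1 - η) * (1 + L) ^ (3 / 2 : ℝ)) δ with hγ
  have hnn : ∀ u, 1 ≤ u → 0 ≤ γ u := fun u hu => dampedSlope_nonneg hL0.le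
    (mul_nonneg (by linarith) (Real.rpow_nonneg (by linarith) _)) hδ0 hu
  have hd : ∀ u, 1 ≤ u → HasDerivAt γ (-(3 / 2) * γ u / (u + L) + δ u / u ^ 2) u :=
    fun u hu => hasDerivAt_dampedSlope hL0.le hδ (one_pos.trans_le hu)
  have h1 : γ 1 = 1 - η := by
    have h : (1 + L) ^ (-(3 / 2) : ℝ) * (1 + L) ^ (3 / 2 : ℝ) = 1 := by
      rw [← Real.rpow_add (by linarith)]
      norm_num
    simp only [hγ, dampedSlope, intervalIntegral.integral_same]
    linear_combination (1 - η) * h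
  have hlt : ∀ u, 1 ≤ u → γ u < 1 := by
    intro u hu
    have hmono : MonotoneOn (fun u => -γ u - (u + L)⁻¹) (Set.Ici 1) := by
      refine monotoneOn_Ici_of_hasDerivAt_nonneg (fun u hu => (hd u hu).neg.sub
        (((hasDerivAt_id u).add_const L).inv (by simp only [id]; linarith))) fun u hu => ?_
      have hu0 : 0 < u := one_pos.trans_le hu
      have hδu : δ u / u ^ 2 ≤ 1 / (u + L) ^ 2 := by
        rcases le_or_gt u L with h | h
        · rw [hδL u h, zero_div]
          positivity
        · rw [div_le_div_iff₀ (by positivity) (by positivity)]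
          have h2 : (u + L) ^ 2 ≤ 4 * u ^ 2 := by nlinarith
          nlinarith [hδ0 u, hδ1 u, mul_le_mul (hδ1 u) h2 (by positivity) (by norm_num)]
      have hγu : 0 ≤ 3 / 2 * γ u / (u + L) :=
        div_nonneg (mul_nonneg (by norm_num) (hnn u hu)) (by linarith)
      have e1 : -(3 / 2) * γ u / (u + L) = -(3 / 2 * γ u / (u + L)) := by ring
      have e2 : -1 / (u + L) ^ 2 = -(1 / (u + L) ^ 2) := by ring
      simp only [id]
      rw [e1, e2]
      linarith
    have h := hmono (Set.mem_Ici.2 le_rfl) (Set.mem_Ici.2 hu) hu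
    simp only [h1] at h
    have h2 : (1 + L)⁻¹ < 1 / L := by
      rw [← one_div]
      exact one_div_lt_one_div_of_lt hL0 (by linarith)
    have h3 : 0 < (u + L)⁻¹ := by positivity
    linarith
  refine ⟨hnn t ht, hlt t ht, ?_⟩
  have hmono : MonotoneOn (fun u => γ u + 3 / 2 / L * u) (Set.Ici 1) := by
    refine monotoneOn_Ici_of_hasDerivAt_nonneg (fun u hu => (hd u hu).add
      ((hasDerivAt_id u).const_mul (3 / 2 / L))) fun u hu => ?_
    have h2 : 3 / 2 * γ u / (u + L) ≤ 3 / 2 / L :=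
      div_le_div₀ (by norm_num) (by linarith [hlt u hu]) hL0 (by linarith)
    have e1 : -(3 / 2) * γ u / (u + L) = -(3 / 2 * γ u / (u + L)) := by ring
    have := div_nonneg (hδ0 u) (sq_nonneg u)
    rw [e1]
    linarith
  have h := hmono (Set.mem_Ici.2 le_rfl) (Set.mem_Ici.2 ht) ht
  simp only [h1] at h
  have e : 3 / 2 * (t - 1) / L = 3 / 2 / L * t - 3 / 2 / L * 1 := by ring
  linarith

/-- A source term can be switched off for `t ≤ L` and left unchanged for `t ≥ 2 L`. -/
theorem exists_switched_source {δ : ℝ → ℝ} (hδ : ContDiff ℝ ∞ δ) (hδ0 : ∀ t, 0 ≤ δ t)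
    (hint : IntegrableOn (fun t => δ t / t) (Set.Ioi 1)) {L : ℝ} (hL : 0 < L) :
    ∃ ε : ℝ → ℝ, ContDiff ℝ ∞ ε ∧ (∀ t, 0 ≤ ε t) ∧ (∀ t, ε t ≤ δ t) ∧ (∀ t, t ≤ L → ε t = 0) ∧
      (∀ t, 2 * L ≤ t → ε t = δ t) ∧ IntegrableOn (fun t => ε t / t) (Set.Ioi 1) := by
  have hεs : ContDiff ℝ ∞ (fun t => δ t * Real.smoothTransition ((t - L) / L)) := by
    apply hδ.mul
    exact Real.smoothTransition.contDiff.comp ((contDiff_id.sub contDiff_const).div_const L)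
  have hε0 : ∀ t, 0 ≤ δ t * Real.smoothTransition ((t - L) / L) := fun t =>
    mul_nonneg (hδ0 t) (Real.smoothTransition.nonneg _)
  have hεδ : ∀ t, δ t * Real.smoothTransition ((t - L) / L) ≤ δ t := fun t =>
    mul_le_of_le_one_right (hδ0 t) (Real.smoothTransition.le_one _)
  refine ⟨_, hεs, hε0, hεδ, fun t ht => ?_, fun t ht => ?_, ?_⟩
  · rw [Real.smoothTransition.zero_of_nonpos, mul_zero]
    exact div_nonpos_of_nonpos_of_nonneg (by linarith) hL.le
  · rw [Real.smoothTransition.one_of_one_le, mul_one]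
    rw [le_div_iff₀ hL]
    linarith
  · refine Integrable.mono hint ?_ ?_
    · apply ContinuousOn.aestronglyMeasurable _ measurableSet_Ioi
      exact hεs.continuous.continuousOn.div continuousOn_id
        fun t ht => ne_of_gt (one_pos.trans ht)
    · filter_upwards [ae_restrict_mem measurableSet_Ioi] with t ht
      have ht0 : (0 : ℝ) < t := one_pos.trans ht
      rw [Real.norm_of_nonneg (div_nonneg (hε0 t) ht0.le),
        Real.norm_of_nonneg (div_nonneg (hδ0 t) ht0.le)]
      exact div_le_div_of_nonneg_right (hεδ t) ht0.le

theorem dampedSlope_ge_of_le_two_mul {L η : ℝ} {δ : ℝ → ℝ} (hδ0 : ∀ t, 0 ≤ δ t) (hL : 0 < L)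
    (hη : η ≤ 1 / 8) {t : ℝ} (ht : 1 ≤ t) (ht2 : t ≤ 2 * L) :
    1 / 8 ≤ dampedSlope L ((1 - η) * (1 + L) ^ (3 / 2 : ℝ)) δ t := by
  refine le_trans ?_ (dampedSlope_lower hL.le hδ0 ht)
  have h1 : (3 * (1 + L)) ^ (-(3 / 2) : ℝ) ≤ (t + L) ^ (-(3 / 2) : ℝ) :=
    Real.rpow_le_rpow_of_nonpos (by linarith) (by linarith) (by norm_num)
  have h2 : (3 * (1 + L)) ^ (-(3 / 2) : ℝ) * (1 + L) ^ (3 / 2 : ℝ) = 3 ^ (-(3 / 2) : ℝ) := by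
    rw [Real.mul_rpow (by norm_num) (by linarith), mul_assoc, ← Real.rpow_add (by linarith)]
    norm_num
  have h3 : (1 / 6 : ℝ) ≤ 3 ^ (-(3 / 2) : ℝ) := by
    have e : (3 : ℝ) ^ (-(3 / 2) : ℝ) = (3 * √3)⁻¹ := by
      rw [Real.rpow_neg (by norm_num), Real.sqrt_eq_rpow, show (3 / 2 : ℝ) = 1 + 1 / 2 by norm_num,
        Real.rpow_add (by norm_num), Real.rpow_one]
    have h4 : √(3 : ℝ) ≤ 2 := by
      rw [Real.sqrt_le_left (by norm_num)]
      norm_num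
    rw [e, ← one_div]
    exact one_div_le_one_div_of_le (by positivity) (by linarith)
  have h5 := mul_le_mul_of_nonneg_right h1 (Real.rpow_nonneg (by linarith : 0 ≤ 1 + L) (3 / 2))
  rw [h2] at h5
  have h6 : (1 / 6 : ℝ) ≤ (t + L) ^ (-(3 / 2) : ℝ) * (1 + L) ^ (3 / 2 : ℝ) := h3.trans h5
  calc (1 / 8 : ℝ) ≤ (1 - η) * (1 / 6) := by linarith
    _ ≤ (1 - η) * ((t + L) ^ (-(3 / 2) : ℝ) * (1 + L) ^ (3 / 2 : ℝ)) :=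
      mul_le_mul_of_nonneg_left h6 (by linarith)
    _ = _ := by ring

/-- The slope function `-γ` with `γ` close to `1` on `1 ≤ t ≤ T` makes both curvatures small there.
Convexity is `γ < 1` for the spherical curvature; for the meridian curvature it holds because `δ`
is switched on only for `t ≥ L`, where the decay of `γ` leaves room for it. -/
theorem exists_radial_supersolution {n : ℕ} (hn : 2 ≤ n) {δ : ℝ → ℝ} (hδ : ContDiff ℝ ∞ δ)
    (hδ0 : ∀ t, 0 ≤ δ t) (hint : IntegrableOn (fun t => δ t / t) (Set.Ioi 1))
    (hlim : Tendsto δ atTop (𝓝 0)) {c T : ℝ} (hc : 0 < c) (hc2 : c ≤ 1 / 2) (hT : 24 ≤ T) :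
    ∃ β Φ : ℝ → ℝ, IsRadialProfile β Φ ∧ Tendsto Φ atTop (𝓝 0) ∧
      (∀ t, 1 ≤ t → 0 < sphericalCurvature β t) ∧
      (∀ t, 1 ≤ t → 0 < meridianCurvature β t) ∧
      (∀ t, 1 ≤ t → t ≤ T → radialOpSq n β t ≤ c ^ 2) ∧
      (∀ t, T ≤ t → radialOpSq n β t ≤ 1 - 2 / n * min (1 / 5) ((1 - 1 / t ^ 2) * δ t)) := by
  obtain ⟨L₀, hL₀⟩ := eventually_atTop.1
    (hlim.eventually (ge_mem_nhds (by norm_num : (0 : ℝ) < 1 / 4)))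
  obtain ⟨L, hL⟩ : ∃ L, L = max L₀ (9 * T ^ 2 / c) := ⟨_, rfl⟩
  have hLc : 9 * T ^ 2 ≤ L * c := (div_le_iff₀ hc).1 (hL ▸ le_max_right _ _)
  have hLδ : ∀ t, L ≤ t → δ t ≤ 1 / 4 := fun t ht =>
    hL₀ t ((hL ▸ le_max_left _ _ : L₀ ≤ L).trans ht)
  have hLT : 18 * T ^ 2 ≤ L := by nlinarith
  have hTL : T ≤ L := by nlinarith
  have hL0 : 0 < L := by linarith
  obtain ⟨ε, hεs, hε0, hεδ, hεL, hε2, hεint⟩ := exists_switched_source hδ hδ0 hint hL0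
  have hε4 : ∀ t, ε t ≤ 1 / 4 := fun t => by
    rcases le_total t L with h | h
    · rw [hεL t h]
      norm_num
    · exact (hεδ t).trans (hLδ t h)
  set A : ℝ := (1 - c / 4) * (1 + L) ^ (3 / 2 : ℝ) with hA
  have hA0 : 0 ≤ A := mul_nonneg (by linarith) (Real.rpow_nonneg (by linarith) _)
  obtain ⟨Φ, hp, hΦ⟩ := exists_isRadialProfile_dampedSlope hL0.le hA0 hεs hε0 hεint
  have hcL : 1 / L ≤ c / 4 := by
    rw [div_le_div_iff₀ hL0 (by norm_num)]
    nlinarith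
  have hbounds : ∀ t, 1 ≤ t → 0 ≤ dampedSlope L A ε t ∧ dampedSlope L A ε t < 1 ∧
      1 - c / 4 - 3 / 2 * (t - 1) / L ≤ dampedSlope L A ε t := fun t ht =>
    dampedSlope_bounds hεs hε0 hε4 hεL (by linarith) (by linarith) hcL ht
  have hlow : ∀ t, 1 ≤ t → t ≤ 2 * L → 1 / 8 ≤ dampedSlope L A ε t := fun t ht ht2 =>
    dampedSlope_ge_of_le_two_mul hε0 hL0 (by linarith) ht ht2
  set γ := dampedSlope L A ε with hγ
  obtain ⟨hw1, hw2, hw3⟩ := two_div_add_sub_two_div hn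
  have hW : ∀ t, 1 ≤ t → lorentzFactor (fun t => -γ t) t ^ 2 = 1 + γ t ^ 2 * (t ^ 2 - 1) := by
    intro t ht
    rw [lorentzFactor_sq ht]
    ring
  have hsph : ∀ t, sphericalCurvature (fun t => -γ t) t
      = lorentzFactor (fun t => -γ t) t - t * γ t := fun t => by
    rw [sphericalCurvature]
    ring
  have hmer : ∀ t, 1 ≤ t → meridianCurvature (fun t => -γ t) t
      = sphericalCurvature (fun t => -γ t) t + 3 / 2 * γ t * ((t ^ 2 - 1) / (t + L))
        - (1 - 1 / t ^ 2) * ε t := fun t ht => by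
    have hd := (hasDerivAt_dampedSlope (A := A) hL0.le hεs (one_pos.trans_le ht)).neg.deriv
    have e : deriv (fun t => -γ t) t = -(-(3 / 2) * γ t / (t + L) + ε t / t ^ 2) := hd
    rw [meridianCurvature, e]
    have : t + L ≠ 0 := by linarith
    have : t ≠ 0 := by linarith
    field_simp
    ring
  have hα : ∀ t, 1 ≤ t → 0 < sphericalCurvature (fun t => -γ t) t := by
    intro t ht
    obtain ⟨h0, h1, -⟩ := hbounds t ht
    rw [hsph, sub_pos]
    apply lt_of_pow_lt_pow_left₀ 2 (lorentzFactor_pos ht).le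
    rw [hW t ht]
    have h2 : γ t ^ 2 < 1 := pow_lt_one₀ h0 h1 two_ne_zero
    linarith
  have hεt : ∀ t, 1 ≤ t → 0 ≤ (1 - 1 / t ^ 2) * ε t ∧ (1 - 1 / t ^ 2) * ε t ≤ 1 / 4 := by
    intro t ht
    have h1 : 0 < 1 / t ^ 2 := by positivity
    have h2 : 0 ≤ 1 - 1 / t ^ 2 := by
      rw [sub_nonneg, div_le_one (by positivity)]
      nlinarith
    exact ⟨mul_nonneg h2 (hε0 t), by nlinarith [hε0 t, hε4 t]⟩
  have hκ : ∀ t, 1 ≤ t → 0 < meridianCurvature (fun t => -γ t) t := by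
    intro t ht
    obtain ⟨h0, h1, -⟩ := hbounds t ht
    have ht1 : 0 ≤ t ^ 2 - 1 := by nlinarith
    rw [hmer t ht]
    rcases le_or_gt t L with h | h
    · rw [hεL t h]
      have : 0 ≤ 3 / 2 * γ t * ((t ^ 2 - 1) / (t + L)) := by
        have := div_nonneg ht1 (by linarith : 0 ≤ t + L)
        positivity
      linarith [hα t ht]
    · have hW1 := one_le_lorentzFactor (β := fun t => -γ t) ht
      have hWγ : γ t * t ≤ lorentzFactor (fun t => -γ t) t := by
        have := hα t ht
        rw [hsph] at this
        linarith
      have h3 : t / 2 - 1 / 4 ≤ (t ^ 2 - 1) / (t + L) := by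
        rw [le_div_iff₀ (by linarith)]
        nlinarith
      have h4 := mul_le_mul_of_nonneg_left h3 h0
      rw [hsph]
      linarith [(hεt t ht).2]
  have hdamped : ∀ t, 1 ≤ t → ∃ s, 0 ≤ s ∧ s ^ 2 = t ^ 2 - 1 ∧
      lorentzFactor (fun t => -γ t) t ^ 2 = 1 + (γ t * s) ^ 2 ∧
      sphericalCurvature (fun t => -γ t) t ≤ lorentzFactor (fun t => -γ t) t - γ t * s ∧
      meridianCurvature (fun t => -γ t) t ≤ lorentzFactor (fun t => -γ t) t + γ t * s / 2
        - (1 - 1 / t ^ 2) * ε t := by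
    intro t ht
    obtain ⟨s, hs0, hst, hs⟩ := exists_sqrt_sq_sub_one ht
    obtain ⟨h0, h1, -⟩ := hbounds t ht
    refine ⟨s, hs0, hs, ?_, ?_, ?_⟩
    · rw [hW t ht, mul_pow, hs]
    · rw [hsph]
      linarith [mul_le_mul_of_nonneg_left hst h0]
    · rw [hmer t ht, hsph]
      have h2 : (t ^ 2 - 1) / (t + L) ≤ s := by
        rw [div_le_iff₀ (by linarith), ← hs]
        linarith [mul_nonneg hs0 hL0.le, mul_nonneg hs0 (sub_nonneg.2 hst)]
      linarith [mul_le_mul_of_nonneg_left hst h0, mul_le_mul_of_nonneg_left h2 h0]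
  have hα1 : ∀ t, 1 ≤ t → sphericalCurvature (fun t => -γ t) t ^ 2 ≤ 1 := by
    intro t ht
    obtain ⟨s, hs0, -, hWs, ha, -⟩ := hdamped t ht
    have hσ : 0 ≤ γ t * s := mul_nonneg (hbounds t ht).1 hs0
    apply pow_le_one₀ (hα t ht).le (ha.trans _)
    have : lorentzFactor (fun t => -γ t) t ≤ 1 + γ t * s := by
      apply le_of_sq_le_sq _ (by linarith)
      linarith
    linarith
  refine ⟨fun t => -γ t, fun t => -Φ t, hp.neg, by simpa using hΦ.neg, hα, hκ,
    fun t ht htT => ?_, fun t htT => ?_⟩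
  · obtain ⟨h0, h1, h2⟩ := hbounds t ht
    have hγ1 : 2 * (1 - γ t) ≤ c / 2 + 3 * T / L := by
      have : 3 / 2 * (t - 1) / L ≤ 3 / 2 * T / L := by
        apply div_le_div_of_nonneg_right _ hL0.le
        linarith
      have e : 3 * T / L = 2 * (3 / 2 * T / L) := by ring
      linarith
    have hα2 : sphericalCurvature (fun t => -γ t) t ≤ 2 * (1 - γ t) := by
      have hW1 := one_le_lorentzFactor (β := fun t => -γ t) ht
      have h3 := hα t ht
      have h4 : sphericalCurvature (fun t => -γ t) t
          * (lorentzFactor (fun t => -γ t) t + t * γ t) = 1 - γ t ^ 2 := by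
        rw [hsph]
        linear_combination hW t ht
      have h5 := mul_le_mul_of_nonneg_left (by linarith [mul_nonneg (by linarith : 0 ≤ t) h0] :
        1 ≤ lorentzFactor (fun t => -γ t) t + t * γ t) h3.le
      linarith [sq_nonneg (1 - γ t)]
    have hk : meridianCurvature (fun t => -γ t) t ≤ c := by
      rw [hmer t ht, hεL t (htT.trans hTL)]
      have h3 : (t ^ 2 - 1) / (t + L) ≤ T ^ 2 / L :=
        div_le_div₀ (by positivity) (by nlinarith) hL0 (by linarith)
      have h4 : 0 ≤ (t ^ 2 - 1) / (t + L) := div_nonneg (by nlinarith) (by linarith)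
      have h5 : 3 * T / L + 3 / 2 * (T ^ 2 / L) ≤ c / 2 := by
        have e : 3 * T / L + 3 / 2 * (T ^ 2 / L) = (3 * T + 3 / 2 * T ^ 2) / L := by ring
        rw [e, div_le_iff₀ hL0]
        nlinarith
      have h6 := mul_le_mul h1.le h3 h4 zero_le_one
      linarith
    have ha : sphericalCurvature (fun t => -γ t) t ≤ c := by
      have : 0 ≤ 3 / 2 * (T ^ 2 / L) := by positivity
      have h5 : 3 * T / L ≤ c / 2 := by
        rw [div_le_iff₀ hL0]
        nlinarith
      linarith
    have h6 : meridianCurvature (fun t => -γ t) t * sphericalCurvature (fun t => -γ t) t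
        ≤ c ^ 2 := by
      rw [pow_two]
      exact mul_le_mul hk ha (hα t ht).le hc.le
    have h7 := pow_le_pow_left₀ (hα t ht).le ha 2
    calc radialOpSq n (fun t => -γ t) t ≤ 2 / n * c ^ 2 + (n - 2) / n * c ^ 2 :=
          add_le_add (mul_le_mul_of_nonneg_left h6 hw1) (mul_le_mul_of_nonneg_left h7 hw2)
      _ = c ^ 2 := by rw [← add_mul, hw3, one_mul]
  · have ht : 1 ≤ t := by linarith
    obtain ⟨s, hs0, hs, hWs, ha, hk⟩ := hdamped t ht
    have hσ : 0 ≤ γ t * s := mul_nonneg (hbounds t ht).1 hs0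
    obtain ⟨hA1, hA2⟩ := mul_le_of_damped hσ (lorentzFactor_pos ht) hWs (hεt t ht).1 (hα t ht)
      ha (hκ t ht).le hk
    have h6 : meridianCurvature (fun t => -γ t) t * sphericalCurvature (fun t => -γ t) t
        ≤ 1 - min (1 / 5) ((1 - 1 / t ^ 2) * δ t) := by
      rcases le_or_gt t (2 * L) with h | h
      · have h8 : 8 ≤ s := by
          apply le_of_sq_le_sq _ hs0
          have := pow_le_pow_left₀ (by norm_num) (hT.trans htT) 2
          linarith
        have := hA2 (by
          linarith [mul_le_mul (hlow t ht h) h8 (by norm_num) (hbounds t ht).1])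
        linarith [min_le_left (1 / 5) ((1 - 1 / t ^ 2) * δ t)]
      · have := hA1 (hεt t ht).2
        rw [hε2 t h.le] at this
        linarith [min_le_right (1 / 5) ((1 - 1 / t ^ 2) * δ t)]
    calc radialOpSq n (fun t => -γ t) t
        ≤ 2 / n * (1 - min (1 / 5) ((1 - 1 / t ^ 2) * δ t)) + (n - 2) / n * 1 :=
          add_le_add (mul_le_mul_of_nonneg_left h6 hw1)
            (mul_le_mul_of_nonneg_left (hα1 t ht) hw2)
      _ = _ := by linear_combination hw3

/-! ### Suprema and infima over hyperbolic spheres -/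

section Spheres

variable {n : ℕ} (o : Hyp n)

local notation "E" => EuclideanSpace ℝ (Fin n)

/-- The Lorentz boost that takes the vertex `(0, 1)` of the hyperboloid to `o`. -/
noncomputable def boost (Z : Mink n) : Mink n :=
  (Z.1 + (inner ℝ o.1.1 Z.1 / (1 + o.1.2) + Z.2) • o.1.1, inner ℝ o.1.1 Z.1 + o.1.2 * Z.2)

theorem continuous_boost : Continuous (boost o) := by
  unfold boost
  fun_prop

theorem minkInner_boost_self (Z : Mink n) : minkInner (boost o Z) (boost o Z) = minkInner Z Z := by
  have ho := o.snd_sq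
  have h1 : 1 + o.1.2 ≠ 0 := by linarith [o.2.2]
  simp only [boost, minkInner, inner_add_left, inner_add_right, real_inner_smul_left,
    real_inner_smul_right, real_inner_comm o.1.1 Z.1]
  rw [real_inner_self_eq_norm_sq o.1.1, (by linarith : ‖o.1.1‖ ^ 2 = o.1.2 ^ 2 - 1)]
  field_simp
  ring

theorem minkInner_boost (Z : Mink n) : minkInner o.1 (boost o Z) = -Z.2 := by
  have ho := o.snd_sq
  have h1 : 1 + o.1.2 ≠ 0 := by linarith [o.2.2]
  simp only [boost, minkInner, inner_add_right, real_inner_smul_right]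
  rw [real_inner_self_eq_norm_sq o.1.1, (by linarith : ‖o.1.1‖ ^ 2 = o.1.2 ^ 2 - 1)]
  field_simp
  ring

theorem exists_boost_eq (X : Mink n) : ∃ Z, boost o Z = X := by
  have ho := o.snd_sq
  have h1 : 1 + o.1.2 ≠ 0 := by linarith [o.2.2]
  -- The inverse is the boost with the opposite velocity.
  refine ⟨(X.1 + (inner ℝ o.1.1 X.1 / (1 + o.1.2) - X.2) • o.1.1,
    o.1.2 * X.2 - inner ℝ o.1.1 X.1), ?_⟩
  have hin : inner ℝ o.1.1 (X.1 + (inner ℝ o.1.1 X.1 / (1 + o.1.2) - X.2) • o.1.1)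
      = o.1.2 * inner ℝ o.1.1 X.1 - X.2 * (o.1.2 ^ 2 - 1) := by
    rw [inner_add_right, real_inner_smul_right, real_inner_self_eq_norm_sq o.1.1,
      (by linarith : ‖o.1.1‖ ^ 2 = o.1.2 ^ 2 - 1)]
    field_simp
    ring
  apply Prod.ext
  · have e : (o.1.2 * inner ℝ o.1.1 X.1 - X.2 * (o.1.2 ^ 2 - 1)) / (1 + o.1.2)
        + (o.1.2 * X.2 - inner ℝ o.1.1 X.1) = -(inner ℝ o.1.1 X.1 / (1 + o.1.2) - X.2) := by
      field_simp
      ring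
    simp only [boost, hin, e]
    module
  · simp only [boost, hin]
    ring

/-- Geodesic polar coordinates about `o`. -/
noncomputable def polar (r : ℝ) (θ : Metric.sphere (0 : E) 1) : Hyp n :=
  ⟨boost o (Real.sinh r • (θ : E), Real.cosh r), by
    have h1 : minkInner (boost o (Real.sinh r • (θ : E), Real.cosh r))
        (boost o (Real.sinh r • (θ : E), Real.cosh r)) = -1 := by
      have hθ : ‖(θ : E)‖ = 1 := by simp
      rw [minkInner_boost_self]
      simp only [minkInner, real_inner_self_eq_norm_sq, norm_smul, hθ, mul_one, Real.norm_eq_abs,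
        sq_abs]
      linarith [Real.cosh_sq r]
    refine ⟨h1, snd_pos_of_minkInner_neg _ o h1 ?_⟩
    rw [minkInner_comm, minkInner_boost]
    simpa using Real.cosh_pos r⟩

theorem continuous_polar : Continuous fun p : ℝ × Metric.sphere (0 : E) 1 => polar o p.1 p.2 := by
  apply Continuous.subtype_mk
  apply (continuous_boost o).comp
  have := Real.continuous_sinh
  have := Real.continuous_cosh
  fun_prop

theorem hypDist_polar {r : ℝ} (hr : 0 ≤ r) (θ : Metric.sphere (0 : E) 1) :
    hypDist o (polar o r θ) = r := by
  have h : minkInner o.1 (polar o r θ).1 = -Real.cosh r := minkInner_boost o _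
  rw [hypDist, h, neg_neg, Real.arcosh_cosh hr]

theorem exists_polar_eq (hn : 0 < n) (x : Hyp n) : ∃ θ, polar o (hypDist o x) θ = x := by
  obtain ⟨Z, hZ⟩ := exists_boost_eq o x.1
  have hZ2 : Z.2 = Real.cosh (hypDist o x) := by
    rw [cosh_hypDist, height, ← hZ, minkInner_boost, neg_neg]
  have hZ1 : ‖Z.1‖ = Real.sinh (hypDist o x) := by
    have h := x.inner_self
    rw [← hZ, minkInner_boost_self] at h
    simp only [minkInner, real_inner_self_eq_norm_sq, hZ2] at h
    apply (sq_eq_sq₀ (norm_nonneg _) (Real.sinh_nonneg_iff.2 (hypDist_nonneg o x))).1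
    linarith [Real.cosh_sq (hypDist o x)]
  have : Nonempty (Fin n) := ⟨⟨0, hn⟩⟩
  obtain ⟨θ, hθ⟩ : ∃ θ : Metric.sphere (0 : E) 1, Real.sinh (hypDist o x) • (θ : E) = Z.1 := by
    rcases eq_or_ne Z.1 0 with h | h
    · obtain ⟨θ⟩ : Nonempty (Metric.sphere (0 : E) 1) :=
        (NormedSpace.sphere_nonempty.2 zero_le_one).to_subtype
      refine ⟨θ, ?_⟩
      rw [← hZ1, h, norm_zero, zero_smul]
    · refine ⟨⟨‖Z.1‖⁻¹ • Z.1, by simp [norm_smul, h]⟩, ?_⟩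
      rw [← hZ1]
      simp [smul_smul, h]
  refine ⟨θ, Subtype.ext ?_⟩
  change boost o (Real.sinh (hypDist o x) • (θ : E), Real.cosh (hypDist o x)) = x.1
  rw [hθ, ← hZ2, hZ]

variable {h : Hyp n → ℝ}

theorem image_sphere_eq (hn : 0 < n) {r : ℝ} (hr : 0 ≤ r) :
    h '' {x | hypDist o x = r} = (fun θ => h (polar o r θ)) '' Set.univ := by
  ext y
  constructor
  · rintro ⟨x, rfl, rfl⟩
    obtain ⟨θ, hθ⟩ := exists_polar_eq o hn x
    exact ⟨θ, trivial, congrArg h hθ⟩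
  · rintro ⟨θ, -, rfl⟩
    exact ⟨polar o r θ, hypDist_polar o hr θ, rfl⟩

theorem exists_continuous_eq_sphereSup (hn : 0 < n) (hcont : Continuous h) :
    ∃ F : ℝ → ℝ, Continuous F ∧ ∀ r, 0 ≤ r → sphereSup o h r = F r := by
  refine ⟨fun r => sSup ((fun θ => h (polar o r θ)) '' Set.univ), ?_, fun r hr => ?_⟩
  · exact isCompact_univ.continuous_sSup (f := fun r θ => h (polar o r θ))
      (hcont.comp (continuous_polar o))
  · rw [sphereSup, image_sphere_eq o hn hr]

theorem isCompact_image_sphere (hn : 0 < n) (hcont : Continuous h) {r : ℝ} (hr : 0 ≤ r) :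
    IsCompact (h '' {x | hypDist o x = r}) := by
  rw [image_sphere_eq o hn hr]
  have hp := (continuous_polar o).comp (Continuous.prodMk_right (Y := Metric.sphere (0 : E) 1) r)
  exact isCompact_univ.image (hcont.comp hp)

theorem le_sphereSup (hn : 0 < n) (hcont : Continuous h) (x : Hyp n) :
    h x ≤ sphereSup o h (hypDist o x) :=
  le_csSup (isCompact_image_sphere o hn hcont (hypDist_nonneg o x)).bddAbove ⟨x, rfl, rfl⟩

theorem exists_eq_sphereSup (hn : 0 < n) (hcont : Continuous h) {r : ℝ} (hr : 0 ≤ r) :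
    ∃ x, hypDist o x = r ∧ h x = sphereSup o h r := by
  have hne : (h '' {x | hypDist o x = r}).Nonempty := by
    have : Nonempty (Fin n) := ⟨⟨0, hn⟩⟩
    obtain ⟨θ⟩ : Nonempty (Metric.sphere (0 : E) 1) :=
      (NormedSpace.sphere_nonempty.2 zero_le_one).to_subtype
    exact ⟨_, polar o r θ, hypDist_polar o hr θ, rfl⟩
  exact (isCompact_image_sphere o hn hcont hr).sSup_mem hne

theorem sphereInf_eq_neg_sphereSup (r : ℝ) :
    sphereInf o h r = -sphereSup o (fun x => -h x) r := by
  rw [sphereInf, sphereSup, Real.sInf_def, ← Set.image_neg_eq_neg, Set.image_image]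

/-- A function with a limit at infinity has the same limit of its suprema over spheres. -/
theorem tendsto_sphereSup (hn : 0 < n) (hcont : Continuous h) {l : ℝ}
    (hlim : TendsToAtInfinity o h l) : Tendsto (sphereSup o h) atTop (𝓝 l) := by
  rw [Metric.tendsto_atTop]
  intro ε hε
  have h1 := hlim.eventually (Metric.ball_mem_nhds l hε)
  rw [eventually_comap] at h1
  obtain ⟨R, hR⟩ := eventually_atTop.1 h1
  refine ⟨max R 0, fun r hr => ?_⟩
  obtain ⟨x, hx, hx'⟩ := exists_eq_sphereSup o hn hcont ((le_max_right _ _).trans hr)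
  rw [← hx']
  exact hR r ((le_max_left _ _).trans hr) x hx

end Spheres

/-! ### Smooth majorants -/

/-- An integrable continuous function of `r ≥ 0` vanishing at infinity has a majorant of the same
kind that is smooth as a function of `t = cosh r`; its integrability in `r` implies that of `δ / t`
in `t`. -/
theorem exists_smooth_majorant {k : ℝ → ℝ} (hk : Continuous k) (h0 : ∀ r, 0 ≤ k r)
    (hint : IntegrableOn k (Set.Ioi 0)) (hlim : Tendsto k atTop (𝓝 0)) :
    ∃ δ : ℝ → ℝ, ContDiff ℝ ∞ δ ∧ (∀ t, 0 ≤ δ t) ∧ (∀ r, 0 ≤ r → k r ≤ δ (Real.cosh r)) ∧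
      IntegrableOn (fun t => δ t / t) (Set.Ioi 1) ∧ Tendsto δ atTop (𝓝 0) := by
  set κ : ℝ → ℝ := fun t => k (Real.arcosh (max 1 t)) with hκ
  have hκc : Continuous κ :=
    hk.comp (Real.continuousOn_arcosh.comp_continuous (continuous_const.max continuous_id)
      fun t => le_max_left 1 t)
  have hec : Continuous fun t : ℝ => (1 + t ^ 2)⁻¹ :=
    (continuous_const.add (continuous_id.pow 2)).inv₀ fun t => by
      have : (0 : ℝ) < 1 + t ^ 2 := by positivity
      exact this.ne'
  have hepos : ∀ t : ℝ, 0 < (1 + t ^ 2)⁻¹ := fun t => by positivity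
  obtain ⟨δ, hδ, hδκ, -⟩ := (hκc.add hec).exists_contDiff_approx ⊤ hec hepos
  have hlo : ∀ t, κ t ≤ δ t := fun t => by
    have := (abs_lt.1 (hδκ t)).1
    simp only [Pi.add_apply] at this
    linarith
  have hhi : ∀ t, δ t ≤ κ t + 2 * (1 + t ^ 2)⁻¹ := fun t => by
    have := (abs_lt.1 (hδκ t)).2
    simp only [Pi.add_apply] at this
    linarith
  have hδ0 : ∀ t, 0 ≤ δ t := fun t => (h0 _).trans (hlo t)
  refine ⟨δ, hδ, hδ0, fun r hr => ?_, ?_, ?_⟩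
  · refine le_trans (le_of_eq ?_) (hlo _)
    simp only [hκ]
    rw [max_eq_right (Real.one_le_cosh r), Real.arcosh_cosh hr]
  · have him : Real.cosh '' Set.Ioi 0 = Set.Ioi 1 := by
      ext t
      constructor
      · rintro ⟨r, hr, rfl⟩
        exact Real.one_lt_cosh.2 (ne_of_gt hr)
      · intro ht
        exact ⟨Real.arcosh t, Real.arcosh_pos ht, Real.cosh_arcosh (le_of_lt ht)⟩
    have hinj : Set.InjOn Real.cosh (Set.Ioi 0) := fun a ha b hb hab => by
      rw [← Real.arcosh_cosh (le_of_lt ha), hab, Real.arcosh_cosh (le_of_lt hb)]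
    have h1 : IntegrableOn (fun t => κ t / t) (Set.Ioi 1) := by
      rw [← him, integrableOn_image_iff_integrableOn_abs_deriv_smul measurableSet_Ioi
        (fun r _ => (Real.hasDerivAt_cosh r).hasDerivWithinAt) hinj]
      refine Integrable.mono hint ?_ ?_
      · apply Continuous.aestronglyMeasurable
        exact Real.continuous_sinh.abs.smul ((hκc.comp Real.continuous_cosh).div
          Real.continuous_cosh fun r => (Real.cosh_pos r).ne')
      · filter_upwards [ae_restrict_mem measurableSet_Ioi] with r hr
        have hr0 : 0 ≤ r := le_of_lt hr
        have e : κ (Real.cosh r) = k r := by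
          simp only [hκ]
          rw [max_eq_right (Real.one_le_cosh r), Real.arcosh_cosh hr0]
        have hs : 0 ≤ Real.sinh r := Real.sinh_nonneg_iff.2 hr0
        rw [e, abs_of_nonneg hs, smul_eq_mul, Real.norm_of_nonneg (h0 r), Real.norm_of_nonneg
          (mul_nonneg hs (div_nonneg (h0 r) (Real.cosh_pos r).le)), ← mul_div_assoc,
          div_le_iff₀ (Real.cosh_pos r), mul_comm]
        exact mul_le_mul_of_nonneg_left (Real.sinh_lt_cosh r).le (h0 r)
    have h2 : IntegrableOn (fun t : ℝ => 2 * (1 + t ^ 2)⁻¹) (Set.Ioi 1) :=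
      (integrable_inv_one_add_sq.const_mul 2).integrableOn
    refine Integrable.mono (h1.add h2) ?_ ?_
    · apply ContinuousOn.aestronglyMeasurable _ measurableSet_Ioi
      exact hδ.continuous.continuousOn.div continuousOn_id
        fun t ht => ne_of_gt (one_pos.trans ht)
    · filter_upwards [ae_restrict_mem measurableSet_Ioi] with t ht
      have ht1 : 1 < t := ht
      have ht0 : 0 < t := one_pos.trans ht1
      have hb : δ t / t ≤ κ t / t + 2 * (1 + t ^ 2)⁻¹ := by
        refine (div_le_div_of_nonneg_right (hhi t) ht0.le).trans ?_
        rw [add_div]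
        have := div_le_self (mul_pos two_pos (hepos t)).le ht1.le
        linarith
      have hnn : 0 ≤ δ t / t := div_nonneg (hδ0 t) ht0.le
      rw [Real.norm_of_nonneg hnn]
      exact hb.trans (le_abs_self _)
  · have har : Tendsto (fun t => Real.arcosh (max 1 t)) atTop atTop := by
      refine tendsto_atTop_mono' _ ?_ Real.tendsto_log_atTop
      filter_upwards [eventually_ge_atTop 1] with t ht
      rw [max_eq_right ht, Real.arcosh]
      exact Real.log_le_log (by linarith) (by linarith [Real.sqrt_nonneg (t ^ 2 - 1)])
    have he : Tendsto (fun t : ℝ => 2 * (1 + t ^ 2)⁻¹) atTop (𝓝 0) := by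
      have h1 : Tendsto (fun t : ℝ => 1 + t ^ 2) atTop atTop :=
        tendsto_atTop_add_const_left _ _ (tendsto_pow_atTop two_ne_zero)
      simpa using h1.inv_tendsto_atTop.const_mul 2
    have hsum : Tendsto (fun t => κ t + 2 * (1 + t ^ 2)⁻¹) atTop (𝓝 0) := by
      simpa using (hlim.comp har).add he
    exact tendsto_of_tendsto_of_tendsto_of_le_of_le tendsto_const_nhds hsum hδ0 hhi

theorem bddAbove_image_Ici_of_tendsto {F : ℝ → ℝ} {l : ℝ} (hF : Continuous F)
    (hlim : Tendsto F atTop (𝓝 l)) : ∃ M, ∀ r, 0 ≤ r → F r ≤ M := by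
  obtain ⟨R, hR⟩ := eventually_atTop.1 (hlim.eventually (ge_mem_nhds (lt_add_one l)))
  obtain ⟨M, hM⟩ := (isCompact_Icc (a := (0 : ℝ)) (b := R)).bddAbove_image hF.continuousOn
  refine ⟨max M (l + 1), fun r hr => ?_⟩
  rcases le_total r R with h | h
  · exact (hM ⟨r, ⟨hr, h⟩, rfl⟩).trans (le_max_left _ _)
  · exact (hR r h).trans (le_max_right _ _)

/-! ### Existence of the radial barriers -/

theorem mainTheorem4 (n : ℕ) (hn : 2 ≤ n) (o : Hyp n) (h : Hyp n → ℝ)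
    (hpos : ∀ x, 0 < h x) (hcont : Continuous h) (hlim : TendsToAtInfinity o h 1)
    (hsup : IntegrableOn (fun r => max (sphereSup o h r - 1) 0) (Set.Ioi 0))
    (hinf : IntegrableOn (fun r => max (1 - sphereInf o h r) 0) (Set.Ioi 0)) :
    ∃ φm φp : Hyp n → ℝ,
      (HypSmooth φm ∧ IsRadial o φm ∧ IsSpacelike φm ∧ IsStrictlyConvexGraph φm ∧
        (∀ x, h x ≤ radialOp 2 φm x) ∧ TendsToAtInfinity o φm 0) ∧
      (HypSmooth φp ∧ IsRadial o φp ∧ IsSpacelike φp ∧ IsStrictlyConvexGraph φp ∧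
        (∀ x, radialOp 2 φp x ≤ h x) ∧ TendsToAtInfinity o φp 0) := by
  have hn0 : 0 < n := by omega
  have hnR : (0 : ℝ) < n := by exact_mod_cast hn0
  have hhalf : ∀ t : ℝ, 2 ≤ t → 1 / 2 ≤ 1 - 1 / t ^ 2 := fun t ht => by
    have : 1 / t ^ 2 ≤ 1 / 2 := one_div_le_one_div_of_le two_pos (by nlinarith)
    linarith
  have hminus : ∃ φ : Hyp n → ℝ, HypSmooth φ ∧ IsRadial o φ ∧ IsSpacelike φ ∧
      IsStrictlyConvexGraph φ ∧ (∀ x, h x ≤ radialOp 2 φ x) ∧ TendsToAtInfinity o φ 0 := by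
    obtain ⟨F, hFc, hF⟩ := exists_continuous_eq_sphereSup o hn0 hcont
    have hFlim : Tendsto F atTop (𝓝 1) := by
      refine (tendsto_sphereSup o hn0 hcont hlim).congr' ?_
      filter_upwards [eventually_ge_atTop 0] with r hr using hF r hr
    have hFpos : ∀ r, 0 ≤ r → 0 < F r := fun r hr => by
      obtain ⟨x, -, hx⟩ := exists_eq_sphereSup o hn0 hcont hr
      rw [← hF r hr, ← hx]
      exact hpos x
    have hhF : ∀ x, h x ≤ F (hypDist o x) := fun x => by
      rw [← hF _ (hypDist_nonneg o x)]
      exact le_sphereSup o hn0 hcont x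
    obtain ⟨M, hM⟩ := bddAbove_image_Ici_of_tendsto hFc hFlim
    -- `n (F² - 1)` is the size of the source that raises `F_2²` to `F²` wherever `tanh² r ≥ 1 / 2`.
    have hkc : Continuous fun r => (n : ℝ) * max (F r ^ 2 - 1) 0 :=
      by fun_prop
    have hkint : IntegrableOn (fun r => (n : ℝ) * max (F r ^ 2 - 1) 0) (Set.Ioi 0) := by
      refine Integrable.mono (hsup.const_mul (n * (M + 1))) hkc.aestronglyMeasurable ?_
      filter_upwards [ae_restrict_mem measurableSet_Ioi] with r hr
      have hr0 : 0 ≤ r := le_of_lt hr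
      have h1 := hFpos r hr0
      have h2 := hM r hr0
      rw [hF r hr0, Real.norm_of_nonneg (by positivity), Real.norm_of_nonneg
        (mul_nonneg (mul_nonneg hnR.le (by linarith)) (le_max_right _ _)), mul_assoc]
      apply mul_le_mul_of_nonneg_left _ hnR.le
      apply max_le _ (mul_nonneg (by linarith) (le_max_right _ _))
      rcases le_total (F r) 1 with h3 | h3
      · exact (by nlinarith : F r ^ 2 - 1 ≤ 0).trans
          (mul_nonneg (by linarith) (le_max_right _ _))
      · rw [max_eq_left (by linarith)]
        nlinarith
    have hklim : Tendsto (fun r => (n : ℝ) * max (F r ^ 2 - 1) 0) atTop (𝓝 0) := by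
      have := (((hFlim.pow 2).sub_const 1).max (tendsto_const_nhds (x := (0 : ℝ)))).const_mul
        (n : ℝ)
      simpa using this
    obtain ⟨δ, hδ, hδ0, hδk, hδint, -⟩ :=
      exists_smooth_majorant hkc (fun r => by positivity) hkint hklim
    obtain ⟨β, Φ, hp, hΦ, hα, hκ, hnear, hfar⟩ := exists_radial_subsolution hn hδ hδ0 hδint
      (le_max_left 2 (6 * M ^ 2))
    refine ⟨fun x => Φ (height o x), hp.hypSmooth o, isRadial_comp_height o Φ, hp.isSpacelike o,
      hp.isStrictlyConvexGraph o hα hκ, fun x => ?_, tendsToAtInfinity_comp_height o hΦ⟩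
    rw [hp.radialOp_eq o hn]
    have ht := one_le_height o x
    have hr := hypDist_nonneg o x
    apply Real.le_sqrt_of_sq_le
    have h1 : h x ^ 2 ≤ F (hypDist o x) ^ 2 := pow_le_pow_left₀ (hpos x).le (hhF x) 2
    refine h1.trans ?_
    rcases le_total (height o x) 2 with h2 | h2
    · have h3 := pow_le_pow_left₀ (hFpos _ hr).le (hM _ hr) 2
      linarith [hnear _ ht h2, le_max_right 2 (6 * M ^ 2)]
    · have h3 := hδk _ hr
      rw [cosh_hypDist] at h3
      have h4 : F (hypDist o x) ^ 2 - 1 ≤ δ (height o x) / n := by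
        rw [le_div_iff₀ hnR, mul_comm]
        exact (mul_le_mul_of_nonneg_left (le_max_left _ _) hnR.le).trans h3
      have h5 : δ (height o x) / n ≤ 2 / n * ((1 - 1 / height o x ^ 2) * δ (height o x)) := by
        rw [div_mul_eq_mul_div]
        apply div_le_div_of_nonneg_right _ hnR.le
        nlinarith [hhalf _ h2, hδ0 (height o x)]
      linarith [hfar _ ht]
  have hplus : ∃ φ : Hyp n → ℝ, HypSmooth φ ∧ IsRadial o φ ∧ IsSpacelike φ ∧
      IsStrictlyConvexGraph φ ∧ (∀ x, radialOp 2 φ x ≤ h x) ∧ TendsToAtInfinity o φ 0 := by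
    have hnegc : Continuous fun x => -h x := hcont.neg
    obtain ⟨F, hFc, hF⟩ := exists_continuous_eq_sphereSup o hn0 hnegc
    obtain ⟨G, hGdef⟩ : ∃ G : ℝ → ℝ, G = fun r => -F r := ⟨_, rfl⟩
    have hGc : Continuous G := hGdef ▸ hFc.neg
    have hG : ∀ r, 0 ≤ r → sphereInf o h r = G r := fun r hr => by
      rw [sphereInf_eq_neg_sphereSup, hF r hr, hGdef]
    have hGlim : Tendsto G atTop (𝓝 1) := by
      have hneg : TendsToAtInfinity o (fun x => -h x) (-1) := hlim.neg
      have h1 := (tendsto_sphereSup o hn0 hnegc hneg).neg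
      rw [neg_neg] at h1
      refine h1.congr' ?_
      filter_upwards [eventually_ge_atTop 0] with r hr
      rw [hF r hr, hGdef]
    have hGpos : ∀ r, 0 ≤ r → 0 < G r := fun r hr => by
      obtain ⟨x, -, hx⟩ := exists_eq_sphereSup o hn0 hnegc hr
      rw [← hG r hr, sphereInf_eq_neg_sphereSup, ← hx, neg_neg]
      exact hpos x
    have hGh : ∀ x, G (hypDist o x) ≤ h x := fun x => by
      rw [← hG _ (hypDist_nonneg o x), sphereInf_eq_neg_sphereSup]
      exact neg_le.1 (le_sphereSup o hn0 hnegc x)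
    obtain ⟨R, hR⟩ := eventually_atTop.1 (((hGlim.pow 2).const_sub 1).eventually
      (ge_mem_nhds (by rw [one_pow, sub_self]; positivity : 1 - 1 ^ 2 < 2 / n * (1 / 5 : ℝ))))
    obtain ⟨c, hc, hc2, hcG⟩ : ∃ c : ℝ, 0 < c ∧ c ≤ 1 / 2 ∧ ∀ r, 0 ≤ r → c ≤ G r := by
      obtain ⟨R', hR'⟩ := eventually_atTop.1
        (hGlim.eventually (le_mem_nhds (by norm_num : (1 / 2 : ℝ) < 1)))
      obtain ⟨r₀, hr₀, hmin⟩ := (isCompact_Icc (a := (0 : ℝ)) (b := max R' 0)).exists_isMinOn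
        ⟨0, le_rfl, le_max_right _ _⟩ hGc.continuousOn
      refine ⟨min (1 / 2) (G r₀), lt_min (by norm_num) (hGpos _ hr₀.1), min_le_left _ _,
        fun r hr => ?_⟩
      rcases le_total r (max R' 0) with h1 | h1
      · exact (min_le_right _ _).trans (hmin ⟨hr, h1⟩)
      · exact (min_le_left _ _).trans (hR' r ((le_max_left _ _).trans h1))
    have hkc : Continuous fun r => (n : ℝ) * max (1 - G r ^ 2) 0 :=
      by fun_prop
    have hkint : IntegrableOn (fun r => (n : ℝ) * max (1 - G r ^ 2) 0) (Set.Ioi 0) := by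
      refine Integrable.mono (hinf.const_mul (n * 2)) hkc.aestronglyMeasurable ?_
      filter_upwards [ae_restrict_mem measurableSet_Ioi] with r hr
      have hr0 : 0 ≤ r := le_of_lt hr
      rw [hG r hr0, Real.norm_of_nonneg (by positivity), Real.norm_of_nonneg (by positivity),
        mul_assoc]
      apply mul_le_mul_of_nonneg_left _ hnR.le
      apply max_le _ (by positivity)
      nlinarith [le_max_left (1 - G r) 0, sq_nonneg (1 - G r)]
    have hklim : Tendsto (fun r => (n : ℝ) * max (1 - G r ^ 2) 0) atTop (𝓝 0) := by
      have := (((hGlim.pow 2).const_sub 1).max (tendsto_const_nhds (x := (0 : ℝ)))).const_mul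
        (n : ℝ)
      simpa using this
    obtain ⟨δ, hδ, hδ0, hδk, hδint, hδlim⟩ :=
      exists_smooth_majorant hkc (fun r => by positivity) hkint hklim
    obtain ⟨β, Φ, hp, hΦ, hα, hκ, hnear, hfar⟩ := exists_radial_supersolution hn hδ hδ0 hδint
      hδlim hc hc2 (le_max_left 24 (Real.cosh R))
    refine ⟨fun x => Φ (height o x), hp.hypSmooth o, isRadial_comp_height o Φ, hp.isSpacelike o,
      hp.isStrictlyConvexGraph o hα hκ, fun x => ?_, tendsToAtInfinity_comp_height o hΦ⟩
    rw [hp.radialOp_eq o hn]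
    have ht := one_le_height o x
    have hr := hypDist_nonneg o x
    rw [Real.sqrt_le_left (hpos x).le]
    refine le_trans ?_ (pow_le_pow_left₀ (hGpos _ hr).le (hGh x) 2)
    rcases le_total (height o x) (max 24 (Real.cosh R)) with h2 | h2
    · exact (hnear _ ht h2).trans (pow_le_pow_left₀ hc.le (hcG _ hr) 2)
    · have hRr : R ≤ hypDist o x := by
        have h3 := (le_max_right _ _).trans h2
        rw [← cosh_hypDist, Real.cosh_le_cosh, abs_of_nonneg hr] at h3
        exact (le_abs_self R).trans h3
      have h24 : 2 ≤ height o x := by linarith [(le_max_left 24 (Real.cosh R)).trans h2]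
      have h3 := hδk _ hr
      rw [cosh_hypDist] at h3
      have h4 : (1 - G (hypDist o x) ^ 2) ≤ 2 / n * (δ (height o x) / 2) := by
        have e : 2 / n * (δ (height o x) / 2) = δ (height o x) / n := by ring
        rw [e, le_div_iff₀ hnR, mul_comm]
        exact (mul_le_mul_of_nonneg_left (le_max_left _ _) hnR.le).trans h3
      have h5 : (1 - G (hypDist o x) ^ 2)
          ≤ 2 / n * min (1 / 5) ((1 - 1 / height o x ^ 2) * δ (height o x)) := by
        rw [mul_min_of_nonneg _ _ (by positivity)]
        refine le_min (hR _ hRr) (h4.trans (mul_le_mul_of_nonneg_left ?_ (by positivity)))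
        nlinarith [hhalf _ h24, hδ0 (height o x)]
      linarith [hfar _ h2]
  obtain ⟨φm, hm⟩ := hminus
  obtain ⟨φp, hp⟩ := hplus
  exact ⟨φm, φp, hm, hp⟩
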